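/- Let $m\in\mathbb N$, let $f:\mathbb R^m\to\mathbb R^m$ and $\Sigma:\mathbb R^m\to\mathbb R^{m\times m}$ be $C^2$, with $\Sigma$ bounded and $\Sigma(x)$ invertible for every $x$, and suppose that there are $\alpha,\beta>0$ with $\langle f(x),x\rangle\le\alpha-\beta|x|^2$ for all $x\in\mathbb R^m$. Fix a maximal step $\Delta_{max}>0$ and a tolerance $0<\tau<2\beta$. For an initial point $X\in\mathbb R^m$, an initial exponent $K\in\{0,1,2,\dots\}$ and i.i.d. standard Gaussian vectors $\eta_1,\eta_2,\dots$ in $\mathbb R^m$, the adaptive Euler scheme is $x_0=X$, $k_{-1}=K$, $$k_n=\min\bigl\{k\in\{0,1,2,\dots\}:\ |f(x_n+2^{-k}\Delta_{max}f(x_n))-f(x_n)|\le\tau,\ k\ge k_{n-1}-1\bigr\},\qquad \Delta_n=2^{-k_n}\Delta_{max},$$ $$x_{n+1}=x_n+\Delta_nf(x_n)+\sqrt{\Delta_n}\,\Sigma(x_n)\eta_{n+1},\qquad t_0=0,\quad t_{n+1}=t_n+\Delta_n.$$ Its piecewise-constant interpolant is $X(t)=x_n$ for $t\in[t_n,t_{n+1})$.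 If $W$ is an $m$-dimensional Brownian motion with $\sqrt{\Delta_n}\,\eta_{n+1}=W(t_{n+1})-W(t_n)$ for all $n$ almost surely, its continuous interpolant is $\overline X(t)=X+\int_0^tf(X(s))\,ds+\int_0^t\Sigma(X(s))\,dW(s)$. Then there is $\lambda>0$ such that for every $T_0>0$ there is $c>0$ for which the following holds for all $X$, all $K$, all such $\eta$ and $W$ on any probability space, and all $T\ge T_0$: almost surely $t_n\to\infty$ (so that the interpolants are defined on $[0,T]$), and $$\mathbb E\exp\Bigl(\lambda\sup_{t\in[0,T]}|X(t)|^2\Bigr)\le\exp(\lambda|X|^2+cT),\qquad \mathbb E\exp\Bigl(\lambda\sup_{t\in[0,T]}|\overline X(t)|^2\Bigr)\le\exp(\lambda|X|^2+cT).$$ (The bound for $X(t)$ does not need $W$.) Here $\lambda$ and $c$ depend on $f,\Sigma,\tau,\Delta_{max}$, and $c$ also on $T_0$, but not on $X$, $K$ or $T\ge T_0$. -/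

import Mathlib

open MeasureTheory ProbabilityTheory
open scoped NNReal

noncomputable section

/-- Real `m`-dimensional Euclidean space. -/
abbrev Euc (m : ℕ) : Type := EuclideanSpace ℝ (Fin m)

/-- `W` is a standard `m`-dimensional Brownian motion: its components are mutually independent
standard one-dimensional Brownian motions (started at `0`, with a.s. continuous paths). -/
structure IsBrownianEuc {Ω : Type*} [MeasurableSpace Ω] {m : ℕ}
    (W : ℝ≥0 → Ω → Euc m) (μ : Measure Ω) : Prop where
  brownian : ∀ i : Fin m, IsBrownianReal (fun t ω => W t ω i) μ
  indep : iIndepFun (fun (i : Fin m) (ω : Ω) (t : ℝ≥0) => W t ω i) μ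

/-- The data of the adaptive Euler scheme for `dx = f(x) dt + Σ(x) dW`: the drift `f`, the
diffusion `Σ` (a field of `m × m` matrices, seen as linear maps), the tolerance `τ` and the
maximal time step. -/
structure AdaptiveScheme (m : ℕ) where
  drift : Euc m → Euc m
  diffusion : Euc m → (Euc m →L[ℝ] Euc m)
  tol : ℝ
  maxStep : ℝ

namespace AdaptiveScheme

variable {m : ℕ} (S : AdaptiveScheme m)

/-- The forward Euler drift map `H(x,t) = x + t f(x)`. -/
def eulerMap (x : Euc m) (t : ℝ) : Euc m := x + t • S.drift x

/-- The step size `2⁻ᵏ Δ_max`. -/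
def stepSize (k : ℕ) : ℝ := S.maxStep / 2 ^ k

/-- `G(x,l) = min {k ≥ 0 : |f(H(x,2⁻ᵏ Δ_max)) - f(x)| ≤ τ and k ≥ l - 1}`. -/
def stepExponent (x : Euc m) (l : ℕ) : ℕ :=
  sInf {k : ℕ | ‖S.drift (S.eulerMap x (S.stepSize k)) - S.drift x‖ ≤ S.tol ∧ l ≤ k + 1}

/-- The chain `(x_n, k_{n-1})`, started at `(X, K)` and driven by the noise sequence `η`; here
`η n` is the noise used in the step from `x_n` to `x_{n+1}`. -/
def chain (K : ℕ) (X : Euc m) (η : ℕ → Euc m) : ℕ → Euc m × ℕ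
  | 0 => (X, K)
  | n + 1 =>
    let x := (chain K X η n).1
    let k := S.stepExponent x (chain K X η n).2
    (S.eulerMap x (S.stepSize k) + √(S.stepSize k) • S.diffusion x (η n), k)

/-- The numerical solution `x_n`. -/
def pos (K : ℕ) (X : Euc m) (η : ℕ → Euc m) (n : ℕ) : Euc m := (S.chain K X η n).1

/-- The time step `Δ_n = 2^{-k_n} Δ_max`; note that `k_n` is the second component of the chain
at index `n + 1`. -/
def step (K : ℕ) (X : Euc m) (η : ℕ → Euc m) (n : ℕ) : ℝ :=
  S.stepSize (S.chain K X η (n + 1)).2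

/-- The grid time `t_n = Δ_0 + ⋯ + Δ_{n-1}`. -/
def time (K : ℕ) (X : Euc m) (η : ℕ → Euc m) (n : ℕ) : ℝ :=
  ∑ i ∈ Finset.range n, S.step K X η i

/-- The last index `n` with `t_n ≤ t`, i.e. the `n` with `t ∈ [t_n, t_{n+1})` when the grid times
tend to infinity and `t ≥ 0`. -/
def index (K : ℕ) (X : Euc m) (η : ℕ → Euc m) (t : ℝ) : ℕ :=
  sSup {n : ℕ | S.time K X η n ≤ t}

/-- The piecewise constant interpolant `X(t) = x_n` for `t ∈ [t_n, t_{n+1})`. -/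
def pcInterp (K : ℕ) (X : Euc m) (η : ℕ → Euc m) (t : ℝ) : Euc m :=
  S.pos K X η (S.index K X η t)

/-- The Itô integral `∫₀ᵗ Σ(X(s)) dW(s)` of the step process `Σ(X(s))`, along one path of `W`. -/
def itoIntegral (K : ℕ) (X : Euc m) (η : ℕ → Euc m) (W : ℝ≥0 → Euc m) (t : ℝ) : Euc m :=
  let N := S.index K X η t
  (∑ n ∈ Finset.range N, S.diffusion (S.pos K X η n)
      (W (S.time K X η (n + 1)).toNNReal - W (S.time K X η n).toNNReal)) +
    S.diffusion (S.pos K X η N) (W t.toNNReal - W (S.time K X η N).toNNReal)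

/-- The continuous interpolant `X̄(t) = X + ∫₀ᵗ f(X(s)) ds + ∫₀ᵗ Σ(X(s)) dW(s)`. -/
def contInterp (K : ℕ) (X : Euc m) (η : ℕ → Euc m) (W : ℝ≥0 → Euc m) (t : ℝ) : Euc m :=
  X + (∫ s in (0 : ℝ)..t, S.drift (S.pcInterp K X η s)) + S.itoIntegral K X η W t

/-- The path `W` drives the scheme: `√Δ_n η_{n+1}` is the increment `W(t_{n+1}) - W(t_n)`
for every `n`. -/
def DrivenBy (K : ℕ) (X : Euc m) (η : ℕ → Euc m) (W : ℝ≥0 → Euc m) : Prop :=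
  ∀ n : ℕ, √(S.step K X η n) • η n =
    W (S.time K X η (n + 1)).toNNReal - W (S.time K X η n).toNNReal

end AdaptiveScheme

/-- The exponential moment `E exp(lam · sup_{t ∈ [0,T]} |Y(t)|²) ∈ [0,∞]` of a process `Y`. -/
def expSupMoment {Ω : Type*} [MeasurableSpace Ω] {m : ℕ} (μ : Measure Ω) (lam T : ℝ)
    (Y : ℝ → Ω → Euc m) : ENNReal :=
  ∫⁻ ω, EReal.exp ((lam : EReal) * ⨆ t ∈ Set.Icc (0 : ℝ) T, ((‖Y t ω‖ ^ 2 : ℝ) : EReal)) ∂μ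

end

/-! Drift. The tolerance test makes the explicit step behave like an implicit one. Put H = x + Δ
f(x) and expand |x|² = |H - Δ f(x)|². Replacing f(x) by f(H) costs at most τ|H|, and coercivity
applies at H. This gives |H|² (1 + Δ(2β - τ)) ≤ |x|² + Δ(2α + τ), where τ < 2β leaves real
dissipation.

Chain. Half of the dissipation absorbs the Gaussian cross term in E exp(λ|x_{n+1}|²) when λ is
small. The other half survives as a gain. Let b be the `rate`, R_n = |x_n|² + `shift` the `sizeSq`,
and M_n = exp(λ(|x_n|² - growth · t_n)) the `weight`. Then the conditional expectation of M_{n+1} is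
at most M_n exp(-λ b R_n Δ_n). The same estimate with 2λ makes M_n² a supermartingale, so E sup M_n
≤ 2 M_0 (`lintegral_iSup_le_two_mul`). This bounds the piecewise constant interpolant. It also gives
t_n → ∞: bounded weights and bounded times would confine the path to a ball, where the step sizes
are bounded below.

Between grid points. The number of steps before T is random and unbounded, so excursions cannot be
paid for one by one at a fixed price. Inside a step started at x_n, the squared norm is at most
|x_n|² + growth · s + b/2 plus an excursion term, -(b/2) R_n s + A|w_s|²/(s + 1/R_n), where w is the
Brownian increment. Expectation of the supremum of exp(λ · excursion) - 1 is at most C(1 - exp(-λ b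
R_n Δ_n)) (`lintegral_iSup_excursionExcess_le`). That is C times the gain left over in the chain
estimate, and E Σ M_n(1 - exp(-λ b R_n Δ_n)) telescopes to at most M_0
(`tsum_lintegral_weight_mul_le`). So the excursions of all steps together cost C exp(λ|X|²).

Independence. The grid times are random, so the excursion estimate needs a strong Markov property.
They take values in the countable set Δ_max · ℚ≥0, so one can split over the value of t_n and use
independence of increments at a fixed time. The resulting prefactors 2 and 2 + C, together with
exp(λ b/2), are absorbed into exp(cT) because T ≥ T_0. -/

/-! ### Integrating out an independent variable. -/

section Independence

/-- Freezing: if `Y` is independent of `𝓕`, then a functional of `𝓕`-measurable data and of `Y` can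
be integrated over an independent copy of `Y` first. -/
theorem lintegral_eq_lintegral_freeze {Ω E : Type*} {𝓕 mΩ : MeasurableSpace Ω} [MeasurableSpace E]
    {μ : Measure Ω} [IsProbabilityMeasure μ] (h𝓕 : 𝓕 ≤ mΩ)
    {Y : Ω → E} (hY : Measurable Y) (hind : Indep 𝓕 (MeasurableSpace.comap Y inferInstance) μ)
    {S : Type*} [MeasurableSpace S] {X : Ω → S} (hX : Measurable[𝓕] X)
    {F : S → E → ENNReal} (hF : Measurable (Function.uncurry F)) :
    ∫⁻ ω, F (X ω) (Y ω) ∂μ = ∫⁻ ω, ∫⁻ ω', F (X ω) (Y ω') ∂μ ∂μ := by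
  have hXm : Measurable X := hX.mono h𝓕 le_rfl
  have hXY : IndepFun X Y μ := by
    rw [IndepFun_iff_Indep]
    exact indep_of_indep_of_le_left hind hX.comap_le
  have hmap := (indepFun_iff_map_prod_eq_prod_map_map hXm.aemeasurable hY.aemeasurable).1 hXY
  calc ∫⁻ ω, F (X ω) (Y ω) ∂μ
      = ∫⁻ p, Function.uncurry F p ∂(μ.map fun ω => (X ω, Y ω)) := by
        rw [lintegral_map hF (hXm.prodMk hY)]; rfl
    _ = ∫⁻ x, ∫⁻ y, F x y ∂(μ.map Y) ∂(μ.map X) := by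
        have := Measure.isProbabilityMeasure_map (μ := μ) hY.aemeasurable
        have := Measure.isProbabilityMeasure_map (μ := μ) hXm.aemeasurable
        rw [hmap, lintegral_prod _ hF.aemeasurable]; rfl
    _ = ∫⁻ ω, ∫⁻ y, F (X ω) y ∂(μ.map Y) ∂μ := by
        have := Measure.isProbabilityMeasure_map (μ := μ) hY.aemeasurable
        exact lintegral_map (f := fun x => ∫⁻ y, F x y ∂(μ.map Y)) hF.lintegral_prod_right' hXm
    _ = _ := by
        refine lintegral_congr fun ω => ?_
        exact lintegral_map (f := fun y => F (X ω) y) (hF.comp measurable_prodMk_left) hY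

/-- One conditional step: bounding the conditional expectation of a functional of `X` and an
independent `Y`. -/
theorem lintegral_mul_le_of_indep {Ω E : Type*} {𝓕 mΩ : MeasurableSpace Ω} [MeasurableSpace E]
    {μ : Measure Ω} [IsProbabilityMeasure μ] (h𝓕 : 𝓕 ≤ mΩ)
    {Y : Ω → E} (hY : Measurable Y) (hind : Indep 𝓕 (MeasurableSpace.comap Y inferInstance) μ)
    {S : Type*} [MeasurableSpace S] {X : Ω → S} (hX : Measurable[𝓕] X)
    {F : S → E → ENNReal} (hF : Measurable (Function.uncurry F)) {G : S → ENNReal}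
    (hFG : ∀ x, ∫⁻ ω, F x (Y ω) ∂μ ≤ G x) {g : Ω → ENNReal} (hg : Measurable[𝓕] g) :
    ∫⁻ ω, g ω * F (X ω) (Y ω) ∂μ ≤ ∫⁻ ω, g ω * G (X ω) ∂μ := by
  have h := lintegral_eq_lintegral_freeze h𝓕 hY hind (X := fun ω => (g ω, X ω)) (hg.prodMk hX)
    (F := fun s y => s.1 * F s.2 y)
    (by
      have h1 : Measurable fun p : (ENNReal × S) × E => F p.1.2 p.2 :=
        hF.comp ((measurable_snd.comp measurable_fst).prodMk measurable_snd)
      exact (measurable_fst.comp measurable_fst).mul h1)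
  rw [h]
  refine lintegral_mono fun ω => ?_
  simp only
  rw [lintegral_const_mul (g ω) (f := fun ω' => F (X ω) (Y ω'))
    (hF.comp (measurable_const.prodMk hY))]
  exact mul_le_mul_right (hFG _) _

end Independence

/-! ### A maximal inequality for square-supermartingales. -/

section Maximal

/-- Maximal inequality: if `M ^ 2` is a supermartingale, then `E sup M ≤ 2 M₀`. -/
theorem lintegral_iSup_le_two_mul {Ω : Type*} {mΩ : MeasurableSpace Ω} {μ : Measure Ω}
    [IsProbabilityMeasure μ] {𝓕 : ℕ → MeasurableSpace Ω} (h𝓕 : ∀ n, 𝓕 n ≤ mΩ) (hmono : Monotone 𝓕)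
    {M : ℕ → Ω → ℝ} (hM : ∀ n, Measurable[𝓕 n] (M n)) (hpos : ∀ n ω, 0 < M n ω) {m₀ : ℝ}
    (hm₀ : ∀ ω, M 0 ω = m₀)
    (hstep : ∀ n (g : Ω → ENNReal), Measurable[𝓕 n] g →
      ∫⁻ ω, g ω * ENNReal.ofReal (M (n + 1) ω ^ 2) ∂μ ≤
        ∫⁻ ω, g ω * ENNReal.ofReal (M n ω ^ 2) ∂μ) :
    ∫⁻ ω, ⨆ n, ENNReal.ofReal (M n ω) ∂μ ≤ ENNReal.ofReal (2 * m₀) := by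
  let S : ℕ → Ω → ℝ := fun n => Nat.rec (M 0) (fun k s ω => max (s ω) (M (k + 1) ω)) n
  have S0 : S 0 = M 0 := rfl
  have SS : ∀ n ω, S (n + 1) ω = max (S n ω) (M (n + 1) ω) := fun n ω => rfl
  have hSm : ∀ n, Measurable[𝓕 n] (S n) := by
    intro n
    induction n with
    | zero => exact hM 0
    | succ n ih => exact (ih.mono (hmono n.le_succ) le_rfl).max (hM (n + 1))
  have hSm' : ∀ n, Measurable (S n) := fun n => (hSm n).mono (h𝓕 n) le_rfl
  have hMm' : ∀ n, Measurable (M n) := fun n => (hM n).mono (h𝓕 n) le_rfl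
  have hSM : ∀ n ω, M n ω ≤ S n ω := by
    intro n ω
    cases n with
    | zero => exact le_rfl
    | succ n => exact le_max_right _ _
  have hSpos : ∀ n ω, 0 < S n ω := fun n ω => (hpos n ω).trans_le (hSM n ω)
  have hSmono : ∀ ω, Monotone fun n => S n ω := fun ω =>
    monotone_nat_of_le_succ fun n => le_max_left _ _
  -- With S the running maximum, S + M²/S has nonincreasing expectation. For fixed M the map s ↦ s +
  -- M²/s is least at s = M, so passing from S n to max (S n) (M (n + 1)) does not raise it. The
  -- supermartingale property, tested against the known factor 1/S n, then replaces M (n + 1)² by M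
  -- n².
  have key : ∀ n, ∫⁻ ω, ENNReal.ofReal (S n ω + M n ω ^ 2 / S n ω) ∂μ ≤ ENNReal.ofReal (2 * m₀) := by
    intro n
    induction n with
    | zero =>
      have : ∀ ω, S 0 ω + M 0 ω ^ 2 / S 0 ω = 2 * m₀ := by
        intro ω
        have h := (hpos 0 ω).ne'
        rw [S0]
        field_simp
        rw [hm₀]; ring
      simp [this]
    | succ n ih =>
      refine le_trans ?_ ih
      have e1 : ∀ k ω, ENNReal.ofReal (S n ω + M k ω ^ 2 / S n ω) =
          ENNReal.ofReal (S n ω) + ENNReal.ofReal (S n ω)⁻¹ * ENNReal.ofReal (M k ω ^ 2) := by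
        intro k ω
        rw [ENNReal.ofReal_add (hSpos n ω).le (div_nonneg (sq_nonneg _) (hSpos n ω).le),
          ← ENNReal.ofReal_mul (inv_nonneg.2 (hSpos n ω).le), div_eq_inv_mul]
      calc ∫⁻ ω, ENNReal.ofReal (S (n + 1) ω + M (n + 1) ω ^ 2 / S (n + 1) ω) ∂μ
          ≤ ∫⁻ ω, ENNReal.ofReal (S n ω + M (n + 1) ω ^ 2 / S n ω) ∂μ := by
            refine lintegral_mono fun ω => ENNReal.ofReal_le_ofReal ?_
            rw [SS]
            rcases le_total (M (n + 1) ω) (S n ω) with h | h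
            · rw [max_eq_left h]
            · rw [max_eq_right h]
              have h1 := hSpos n ω
              have h2 := hpos (n + 1) ω
              rw [← sub_nonneg]
              have : S n ω + M (n + 1) ω ^ 2 / S n ω -
                  (M (n + 1) ω + M (n + 1) ω ^ 2 / M (n + 1) ω) =
                  (S n ω - M (n + 1) ω) ^ 2 / S n ω := by
                field_simp; ring
              rw [this]; positivity
        _ = ∫⁻ ω, ENNReal.ofReal (S n ω) ∂μ +
            ∫⁻ ω, ENNReal.ofReal (S n ω)⁻¹ * ENNReal.ofReal (M (n + 1) ω ^ 2) ∂μ := by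
            simp_rw [e1]
            exact lintegral_add_left (hSm' n).ennreal_ofReal _
        _ ≤ ∫⁻ ω, ENNReal.ofReal (S n ω) ∂μ +
            ∫⁻ ω, ENNReal.ofReal (S n ω)⁻¹ * ENNReal.ofReal (M n ω ^ 2) ∂μ :=
            add_le_add_right (hstep n _ (hSm n).inv.ennreal_ofReal) _
        _ = _ := by
            simp_rw [e1]
            exact (lintegral_add_left (hSm' n).ennreal_ofReal _).symm
  calc ∫⁻ ω, ⨆ n, ENNReal.ofReal (M n ω) ∂μ
      ≤ ∫⁻ ω, ⨆ n, ENNReal.ofReal (S n ω) ∂μ :=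
        lintegral_mono fun ω => iSup_mono fun n => ENNReal.ofReal_le_ofReal (hSM n ω)
    _ = ⨆ n, ∫⁻ ω, ENNReal.ofReal (S n ω) ∂μ :=
        lintegral_iSup (fun n => (hSm' n).ennreal_ofReal)
          fun i j hij ω => ENNReal.ofReal_le_ofReal (hSmono ω hij)
    _ ≤ _ := iSup_le fun n => (lintegral_mono fun ω => ENNReal.ofReal_le_ofReal
        (le_add_of_nonneg_right (div_nonneg (sq_nonneg _) (hSpos n ω).le))).trans (key n)

end Maximal

/-! ### Exponential moments of Gaussian vectors. -/

section Gaussian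

/-- Completing the square turns the integrand into a multiple of another Gaussian density, with
variance v/(1 - 2pv) and mean qv/(1 - 2pv). -/
theorem lintegral_exp_quadratic_gaussianReal (v : ℝ≥0) {p : ℝ} (q : ℝ) (hp : 2 * p * v < 1) :
    ∫⁻ x, ENNReal.ofReal (Real.exp (p * x ^ 2 + q * x)) ∂(gaussianReal 0 v) =
      ENNReal.ofReal ((√(1 - 2 * p * v))⁻¹ * Real.exp (q ^ 2 * v / (2 * (1 - 2 * p * v)))) := by
  rcases eq_or_ne v 0 with rfl | hv
  · simp
  have hr : 0 < 1 - 2 * p * v := by linarith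
  set r := 1 - 2 * p * v with hrdef
  have hv' : (0 : ℝ) < v := by positivity
  have hv2 : Real.toNNReal (v / r) ≠ 0 := by
    simpa using div_pos hv' hr
  rw [gaussianReal_of_var_ne_zero _ hv,
    lintegral_withDensity_eq_lintegral_mul _ (measurable_gaussianPDF _ _) (by fun_prop)]
  have key : ∀ x, (gaussianPDF 0 v * fun x => ENNReal.ofReal (Real.exp (p * x ^ 2 + q * x))) x =
      ENNReal.ofReal ((√r)⁻¹ * Real.exp (q ^ 2 * v / (2 * r))) *
        gaussianPDF (q * v / r) (Real.toNNReal (v / r)) x := by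
    intro x
    simp only [Pi.mul_apply, gaussianPDF]
    rw [← ENNReal.ofReal_mul (gaussianPDFReal_nonneg _ _ _), ← ENNReal.ofReal_mul (by positivity)]
    congr 1
    rw [gaussianPDFReal, gaussianPDFReal, Real.coe_toNNReal _ (div_pos hv' hr).le]
    have hs : √(2 * Real.pi * (v / r)) = √(2 * Real.pi * v) / √r := by
      rw [← Real.sqrt_div (by positivity)]; congr 1; ring
    rw [hs, inv_div, mul_assoc, ← Real.exp_add]
    have hsr : √r ≠ 0 := (Real.sqrt_pos.2 hr).ne'
    have : (√r)⁻¹ * Real.exp (q ^ 2 * v / (2 * r)) * (√r / √(2 * Real.pi * v) *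
        Real.exp (-(x - q * v / r) ^ 2 / (2 * (v / r)))) = (√(2 * Real.pi * v))⁻¹ *
        Real.exp (q ^ 2 * v / (2 * r) + -(x - q * v / r) ^ 2 / (2 * (v / r))) := by
      rw [Real.exp_add]; field_simp
    rw [this]
    congr 2
    have hp' : p = (1 - r) / (2 * v) := by rw [hrdef]; field_simp; ring
    rw [hp']
    field_simp
    ring
  simp_rw [key]
  rw [lintegral_const_mul _ (measurable_gaussianPDF _ _), lintegral_gaussianPDF_eq_one _ hv2,
    mul_one]

theorem inv_sqrt_one_sub_le {u : ℝ} (h0 : 0 ≤ u) (h1 : u ≤ 1 / 2) : (√(1 - u))⁻¹ ≤ 1 + u := by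
  have hpos : 0 < √(1 - u) := Real.sqrt_pos.2 (by linarith)
  rw [inv_le_iff_one_le_mul₀ hpos]
  have h : (1 : ℝ) ≤ ((1 + u) * √(1 - u)) ^ 2 := by
    rw [mul_pow, Real.sq_sqrt (by linarith)]
    nlinarith [mul_nonneg h0 (mul_nonneg h0 h0), mul_nonneg h0 (sub_nonneg.2 h1)]
  nlinarith [mul_pos (show (0 : ℝ) < 1 + u by linarith) hpos]

/-- A form of the convexity of the exponential, valid also for `m = 0`. -/
theorem exp_sum_sub_one_le {m : ℕ} (a : Fin m → ℝ) (ha : ∀ i, 0 ≤ a i) :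
    Real.exp (∑ i, a i) - 1 ≤ ∑ i, (Real.exp (m * a i) - 1) := by
  rcases Nat.eq_zero_or_pos m with rfl | hm
  · simp
  have hm' : (1 : ℝ) ≤ m := by exact_mod_cast hm
  have h := convexOn_exp.map_sum_le (t := Finset.univ) (w := fun _ : Fin m => (m : ℝ)⁻¹)
    (p := fun i => m * a i) (fun _ _ => by positivity) (by simp; field_simp) (by simp)
  have e : ∀ i, (m : ℝ)⁻¹ • (m * a i) = a i := fun i => by
    simp only [smul_eq_mul]; field_simp
  simp only [e, smul_eq_mul] at h
  have e2 : ∑ i, (Real.exp (m * a i) - 1) = m * (∑ i, (m : ℝ)⁻¹ * Real.exp (m * a i) - 1) := by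
    rw [Finset.sum_sub_distrib, ← Finset.mul_sum]; simp; field_simp
  rw [e2]
  have h0 : 0 ≤ ∑ i, a i := Finset.sum_nonneg fun i _ => ha i
  have h1 := Real.add_one_le_exp (∑ i, a i)
  nlinarith

theorem hasLaw_apply_stdGaussian {m : ℕ} (i : Fin m) :
    (stdGaussian (Euc m)).map (fun z => z i) = gaussianReal 0 1 := by
  rw [← map_pi_eq_stdGaussian, Measure.map_map (by fun_prop) (by fun_prop)]
  exact (measurePreserving_eval (fun _ : Fin m => gaussianReal 0 1) i).map_eq

/-- Convexity of exp reduces the norm to its coordinates at the price of a factor m in the exponent.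
The condition on p keeps 2mp ≤ 1/2, so that each one-dimensional moment is at most 1 + 2mp. -/
theorem lintegral_exp_norm_sq_stdGaussian_le {m : ℕ} {p : ℝ} (hp : 0 ≤ p) (hmp : 4 * m * p ≤ 1) :
    ∫⁻ z, ENNReal.ofReal (Real.exp (p * ‖z‖ ^ 2)) ∂(stdGaussian (Euc m)) ≤
      ENNReal.ofReal (Real.exp (2 * m ^ 2 * p)) := by
  -- The term m is added instead of being subtracted on the other side, because subtraction in
  -- `ENNReal` is truncated.
  have h1 : ∀ z : Euc m, ENNReal.ofReal (Real.exp (p * ‖z‖ ^ 2)) + m ≤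
      1 + ∑ i : Fin m, ENNReal.ofReal (Real.exp (m * p * z i ^ 2 + 0 * z i)) := by
    intro z
    have := exp_sum_sub_one_le (fun i => p * z i ^ 2) fun i => by positivity
    rw [← Finset.mul_sum] at this
    have hz : ‖z‖ ^ 2 = ∑ i, z i ^ 2 := by
      rw [EuclideanSpace.norm_sq_eq]; simp
    rw [hz, ← ENNReal.ofReal_sum_of_nonneg (fun i _ => (Real.exp_pos _).le), ← ENNReal.ofReal_one,
      ← ENNReal.ofReal_add zero_le_one (Finset.sum_nonneg fun i _ => (Real.exp_pos _).le),
      ← ENNReal.ofReal_natCast, ← ENNReal.ofReal_add (Real.exp_pos _).le (Nat.cast_nonneg _)]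
    apply ENNReal.ofReal_le_ofReal
    rw [Finset.sum_sub_distrib] at this
    simp only [Finset.sum_const, Finset.card_univ, Fintype.card_fin, nsmul_eq_mul, mul_one] at this
    simp only [zero_mul, add_zero, mul_assoc]
    linarith
  have h2 : ∀ i : Fin m, ∫⁻ z : Euc m, ENNReal.ofReal (Real.exp (m * p * z i ^ 2 + 0 * z i))
      ∂(stdGaussian (Euc m)) ≤ ENNReal.ofReal (1 + 2 * m * p) := by
    intro i
    have hm := hasLaw_apply_stdGaussian i
    have := lintegral_map (μ := stdGaussian (Euc m)) (g := fun z : Euc m => z i)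
      (f := fun x : ℝ => ENNReal.ofReal (Real.exp (m * p * x ^ 2 + 0 * x))) (by fun_prop)
      (by fun_prop)
    rw [← this, hm, lintegral_exp_quadratic_gaussianReal _ _ (by simp; linarith)]
    apply ENNReal.ofReal_le_ofReal
    have := inv_sqrt_one_sub_le (u := 2 * (m * p)) (by positivity) (by linarith)
    simp at this ⊢
    linarith
  have h3 : ∫⁻ z, ENNReal.ofReal (Real.exp (p * ‖z‖ ^ 2)) ∂(stdGaussian (Euc m)) + m ≤
      1 + ∑ i : Fin m, ENNReal.ofReal (1 + 2 * m * p) := by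
    calc ∫⁻ z, ENNReal.ofReal (Real.exp (p * ‖z‖ ^ 2)) ∂(stdGaussian (Euc m)) + m
        = ∫⁻ z, (ENNReal.ofReal (Real.exp (p * ‖z‖ ^ 2)) + m) ∂(stdGaussian (Euc m)) := by
          rw [lintegral_add_right _ measurable_const]; simp
      _ ≤ ∫⁻ z, (1 + ∑ i : Fin m, ENNReal.ofReal (Real.exp (m * p * z i ^ 2 + 0 * z i)))
            ∂(stdGaussian (Euc m)) := lintegral_mono h1
      _ = 1 + ∑ i : Fin m, ∫⁻ z, ENNReal.ofReal (Real.exp (m * p * z i ^ 2 + 0 * z i))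
            ∂(stdGaussian (Euc m)) := by
          rw [lintegral_add_left measurable_const, lintegral_finsetSum _ (by fun_prop)]; simp
      _ ≤ _ := by gcongr with i; exact h2 i
  have h4 : (1 : ENNReal) + ∑ i : Fin m, ENNReal.ofReal (1 + 2 * m * p) =
      ENNReal.ofReal (1 + 2 * m ^ 2 * p) + m := by
    rw [Finset.sum_const, Finset.card_univ, Fintype.card_fin, nsmul_eq_mul,
      ← ENNReal.ofReal_natCast, ← ENNReal.ofReal_mul (Nat.cast_nonneg _), ← ENNReal.ofReal_one,
      ← ENNReal.ofReal_add zero_le_one (by positivity),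
      ← ENNReal.ofReal_add (by positivity) (Nat.cast_nonneg _)]
    congr 1; ring
  rw [h4] at h3
  refine (ENNReal.le_of_add_le_add_right (ENNReal.natCast_ne_top m) h3).trans ?_
  apply ENNReal.ofReal_le_ofReal
  have := Real.add_one_le_exp (2 * m ^ 2 * p)
  linarith

theorem lintegral_exp_inner_stdGaussian {m : ℕ} (v : Euc m) :
    ∫⁻ z, ENNReal.ofReal (Real.exp (inner ℝ v z)) ∂(stdGaussian (Euc m)) =
      ENNReal.ofReal (Real.exp (‖v‖ ^ 2 / 2)) := by
  have hmap : (stdGaussian (Euc m)).map (innerSL ℝ v) =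
      gaussianReal 0 (Real.toNNReal (‖v‖ ^ 2)) := by
    rw [IsGaussian.map_eq_gaussianReal, integral_strongDual_stdGaussian, variance_dual_stdGaussian]
    simp
  have h := lintegral_map (μ := stdGaussian (Euc m)) (g := innerSL ℝ v)
      (f := fun x : ℝ => ENNReal.ofReal (Real.exp (0 * x ^ 2 + 1 * x))) (by fun_prop)
      (by fun_prop)
  rw [hmap, lintegral_exp_quadratic_gaussianReal _ _ (by simp)] at h
  simpa using h.symm

end Gaussian

/-! ### A maximal inequality for the exponential square of Brownian motion. -/

section Brownian

/-- The function (δ + s)^(-1/2) exp(y²/(2(δ + s))) solves the backward heat equation, so its value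
along a Brownian path is a martingale. This is the transition identity, with σ the value of δ + s at
the end of a time interval of length h. -/
theorem lintegral_exp_add_sq_gaussianReal (h : ℝ≥0) {σ : ℝ} (hσ : (h : ℝ) < σ) (y : ℝ) :
    ∫⁻ z, ENNReal.ofReal ((√σ)⁻¹ * Real.exp ((y + z) ^ 2 / (2 * σ))) ∂(gaussianReal 0 h) =
      ENNReal.ofReal ((√(σ - h))⁻¹ * Real.exp (y ^ 2 / (2 * (σ - h)))) := by
  have hσ0 : 0 < σ := h.coe_nonneg.trans_lt hσ
  have hσh : 0 < σ - h := sub_pos.2 hσ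
  have hp : 2 * (1 / (2 * σ)) * (h : ℝ) < 1 := by
    rw [show 2 * (1 / (2 * σ)) * (h : ℝ) = h / σ by field_simp, div_lt_one hσ0]; exact hσ
  have e : ∀ z : ℝ, ENNReal.ofReal ((√σ)⁻¹ * Real.exp ((y + z) ^ 2 / (2 * σ))) =
      ENNReal.ofReal ((√σ)⁻¹ * Real.exp (y ^ 2 / (2 * σ))) *
        ENNReal.ofReal (Real.exp (1 / (2 * σ) * z ^ 2 + y / σ * z)) := by
    intro z
    rw [← ENNReal.ofReal_mul (by positivity), mul_assoc, ← Real.exp_add]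
    congr 3
    field_simp; ring
  simp_rw [e]
  rw [lintegral_const_mul _ (by fun_prop), lintegral_exp_quadratic_gaussianReal _ _ hp,
    ← ENNReal.ofReal_mul (by positivity)]
  congr 1
  have e1 : 1 - 2 * (1 / (2 * σ)) * (h : ℝ) = (σ - h) / σ := by field_simp
  rw [e1, Real.sqrt_div hσh.le, inv_div]
  have h1 : √σ ≠ 0 := (Real.sqrt_pos.2 hσ0).ne'
  have h2 : √(σ - h) ≠ 0 := (Real.sqrt_pos.2 hσh).ne'
  have e2 : (√σ)⁻¹ * Real.exp (y ^ 2 / (2 * σ)) * (√σ / √(σ - h) *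
      Real.exp ((y / σ) ^ 2 * h / (2 * ((σ - h) / σ)))) = (√(σ - h))⁻¹ *
      Real.exp (y ^ 2 / (2 * σ) + (y / σ) ^ 2 * h / (2 * ((σ - h) / σ))) := by
    rw [Real.exp_add]; field_simp
  rw [e2]
  congr 2
  have h3 : σ - (h : ℝ) ≠ 0 := hσh.ne'
  field_simp
  ring

variable {Ω : Type*} {mΩ : MeasurableSpace Ω} {μ : Measure Ω}

/-- The maximal inequality is applied to the square root of the heat martingale. Since s n ≤ δ, its
exponent is at least y²/(8δ) and its prefactor at least 1/2, which costs the factor 2 in front of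
the bound 2 for the supremum. -/
theorem lintegral_iSup_exp_sq_brownian_seq_le [IsProbabilityMeasure μ] {B : ℝ≥0 → Ω → ℝ}
    (hB : IsPreBrownianReal B μ) (hBm : ∀ t, Measurable (B t)) (hB0 : ∀ ω, B 0 ω = 0)
    {δ : ℝ} (hδ : 0 < δ) {s : ℕ → ℝ≥0} (hs : Monotone s) (hs0 : s 0 = 0)
    (hsδ : ∀ n, (s n : ℝ) ≤ δ) :
    ∫⁻ ω, ⨆ n, ENNReal.ofReal (Real.exp (B (s n) ω ^ 2 / (8 * δ))) ∂μ ≤ 4 := by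
  let 𝓕 : ℕ → MeasurableSpace Ω := fun n =>
    MeasurableSpace.comap (fun ω (t : Set.Iic (s n)) => B t ω) inferInstance
  have hpast : ∀ n, Measurable fun ω (t : Set.Iic (s n)) => B t ω := fun n =>
    measurable_pi_lambda _ fun t => hBm t
  have h𝓕 : ∀ n, 𝓕 n ≤ mΩ := fun n => (hpast n).comap_le
  have hBF : ∀ n (t : ℝ≥0), t ≤ s n → Measurable[𝓕 n] (B t) := fun n t ht =>
    (measurable_pi_apply (⟨t, ht⟩ : Set.Iic (s n))).comp
      (comap_measurable fun ω (t : Set.Iic (s n)) => B t ω)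
  have hmono : Monotone 𝓕 := by
    intro i j hij
    refine Measurable.comap_le ?_
    exact @measurable_pi_lambda _ _ _ (𝓕 j) _ _ fun t => hBF j t (le_trans t.2 (hs hij))
  let u : ℕ → ℝ → ℝ := fun n y => √δ * ((√(δ + s n))⁻¹ * Real.exp (y ^ 2 / (2 * (δ + s n))))
  have hσ : ∀ n, 0 < δ + s n := fun n => add_pos_of_pos_of_nonneg hδ (s n).coe_nonneg
  have hupos : ∀ n y, 0 < u n y := fun n y => by have := hσ n; positivity
  have hum : ∀ n, Measurable (u n) := fun n => by fun_prop
  have hmax := lintegral_iSup_le_two_mul (μ := μ) h𝓕 hmono (M := fun n ω => √(u n (B (s n) ω)))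
    (fun n => ((hum n).sqrt).comp (hBF n _ le_rfl)) (fun n ω => Real.sqrt_pos.2 (hupos _ _))
    (m₀ := 1) (fun ω => by
      have : √δ ≠ 0 := (Real.sqrt_pos.2 hδ).ne'
      simp [u, hs0, hB0, this]) (by
      intro n g hg
      simp only [Real.sq_sqrt (hupos _ _).le]
      set h : ℝ≥0 := s (n + 1) - s n with hh
      have hsum : s (n + 1) = s n + h := (add_tsub_cancel_of_le (hs n.le_succ)).symm
      have hYm : Measurable fun ω => B (s n + h) ω - B (s n) ω := (hBm _).sub (hBm _)
      have hind : Indep (𝓕 n)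
          (MeasurableSpace.comap (fun ω => B (s n + h) ω - B (s n) ω) inferInstance) μ := by
        have h1 := (hB.indepFun_shift (s n)).symm.comp measurable_id (measurable_pi_apply h)
        exact h1
      have hlaw := ((hB.shift (s n)).hasLaw_eval h).map_eq
      have key := lintegral_mul_le_of_indep (h𝓕 n) hYm hind (X := B (s n)) (hBF n _ le_rfl)
        (F := fun y z => ENNReal.ofReal (u (n + 1) (y + z)))
        (((hum (n + 1)).comp (measurable_fst.add measurable_snd)).ennreal_ofReal)
        (G := fun y => ENNReal.ofReal (u n y)) (fun y => by
          have e := lintegral_map (μ := μ) (g := fun ω => B (s n + h) ω - B (s n) ω)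
            (f := fun z => ENNReal.ofReal (u (n + 1) (y + z)))
            ((hum (n + 1)).comp (measurable_const.add measurable_id)).ennreal_ofReal hYm
          rw [← e, hlaw]
          simp only [u]
          have hlt : (h : ℝ) < δ + s (n + 1) := by
            rw [hsum]; push_cast; linarith [(s n).coe_nonneg]
          simp_rw [ENNReal.ofReal_mul (Real.sqrt_nonneg δ)]
          rw [lintegral_const_mul _ (by fun_prop), lintegral_exp_add_sq_gaussianReal h hlt]
          rw [show δ + (s (n + 1) : ℝ) - h = δ + s n by rw [hsum]; push_cast; ring]) hg
      simpa [hsum] using key)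
  calc ∫⁻ ω, ⨆ n, ENNReal.ofReal (Real.exp (B (s n) ω ^ 2 / (8 * δ))) ∂μ
      ≤ ∫⁻ ω, 2 * ⨆ n, ENNReal.ofReal (√(u n (B (s n) ω))) ∂μ := by
        refine lintegral_mono fun ω => iSup_le fun n => ?_
        refine le_trans ?_ (mul_le_mul_right (le_iSup _ n) 2)
        rw [← ENNReal.ofReal_ofNat, ← ENNReal.ofReal_mul (by norm_num)]
        apply ENNReal.ofReal_le_ofReal
        have h1 : Real.exp (B (s n) ω ^ 2 / (8 * δ)) ^ 2 / 4 ≤ u n (B (s n) ω) := by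
          have h2 : Real.exp (B (s n) ω ^ 2 / (8 * δ)) ^ 2 ≤
              Real.exp (B (s n) ω ^ 2 / (2 * (δ + s n))) := by
            rw [← Real.exp_nat_mul]
            apply Real.exp_le_exp.2
            rw [show ((2 : ℕ) : ℝ) * (B (s n) ω ^ 2 / (8 * δ)) = B (s n) ω ^ 2 / (4 * δ) by
              push_cast; field_simp; ring]
            exact div_le_div_of_nonneg_left (sq_nonneg _) (by have := hσ n; positivity)
              (by linarith [hsδ n])
          have h3 : 1 / 4 ≤ √δ * (√(δ + s n))⁻¹ := by
            rw [← div_eq_mul_inv, ← Real.sqrt_div hδ.le]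
            apply Real.le_sqrt_of_sq_le
            rw [le_div_iff₀ (hσ n)]
            linarith [hsδ n]
          have h4 := Real.exp_pos (B (s n) ω ^ 2 / (2 * (δ + s n)))
          simp only [u]
          rw [← mul_assoc]
          nlinarith
        have h5 : Real.exp (B (s n) ω ^ 2 / (8 * δ)) / 2 ≤ √(u n (B (s n) ω)) := by
          apply Real.le_sqrt_of_sq_le
          rw [div_pow]; norm_num; exact h1
        linarith
    _ = 2 * ∫⁻ ω, ⨆ n, ENNReal.ofReal (√(u n (B (s n) ω))) ∂μ :=
        lintegral_const_mul _ (Measurable.iSup fun n =>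
          (((hum n).comp (hBm _)).sqrt).ennreal_ofReal)
    _ ≤ 2 * ENNReal.ofReal (2 * 1) := by gcongr
    _ = 4 := by rw [mul_one, ENNReal.ofReal_ofNat]; norm_num

/-- Lists finitely many times in increasing order for use with a discrete martingale. Zero is
adjoined so that the martingale starts from a deterministic value. -/
theorem exists_monotone_seq_of_finset (F : Finset ℝ≥0) {δ : ℝ≥0} (hF : ∀ q ∈ F, q ≤ δ) :
    ∃ s : ℕ → ℝ≥0, Monotone s ∧ s 0 = 0 ∧ (∀ n, s n ≤ δ) ∧ ∀ q ∈ F, ∃ n, s n = q := by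
  classical
  set F' := insert 0 F with hF'
  have hpos : 0 < F'.card := Finset.card_pos.2 ⟨0, Finset.mem_insert_self _ _⟩
  let f := F'.orderEmbOfFin rfl
  have hlt : ∀ n : ℕ, min n (F'.card - 1) < F'.card := fun n => by omega
  have hmem : ∀ i, f i ∈ F' := fun i => Finset.orderEmbOfFin_mem _ _ _
  refine ⟨fun n => f ⟨min n (F'.card - 1), hlt n⟩, ?_, ?_, ?_, ?_⟩
  · intro i j hij
    apply f.monotone
    simp only [Fin.mk_le_mk]
    omega
  · obtain ⟨i, hi⟩ : (0 : ℝ≥0) ∈ Set.range f := by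
      rw [Finset.range_orderEmbOfFin]; simp [hF']
    apply le_antisymm _ zero_le
    rw [← hi]
    exact f.monotone (by simp [Fin.le_def])
  · intro n
    rcases Finset.mem_insert.1 (hmem ⟨min n (F'.card - 1), hlt n⟩) with h | h
    · simp only [h]; exact zero_le
    · exact hF _ h
  · intro q hq
    obtain ⟨i, hi⟩ : q ∈ Set.range f := by
      rw [Finset.range_orderEmbOfFin]; simp [hF', hq]
    refine ⟨i, ?_⟩
    rw [← hi]
    refine congrArg f (Fin.ext ?_)
    have := i.2
    exact min_eq_left (by omega)

/-- Doob's maximal inequality for the exponential square of a Brownian motion. -/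
theorem lintegral_iSup_exp_sq_brownian_le [IsProbabilityMeasure μ] {B : ℝ≥0 → Ω → ℝ}
    (hB : IsPreBrownianReal B μ) (hBm : ∀ t, Measurable (B t)) (hB0 : ∀ ω, B 0 ω = 0)
    {δ : ℝ} (hδ : 0 < δ) {ι : Type*} [Countable ι] (q : ι → ℝ≥0) :
    ∫⁻ ω, ⨆ i, ⨆ _ : (q i : ℝ) ≤ δ, ENNReal.ofReal (Real.exp (B (q i) ω ^ 2 / (8 * δ))) ∂μ ≤ 4 := by
  classical
  have hm : ∀ i, Measurable fun ω =>
      ⨆ _ : (q i : ℝ) ≤ δ, ENNReal.ofReal (Real.exp (B (q i) ω ^ 2 / (8 * δ))) := fun i =>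
    Measurable.iSup_Prop _ (by have := hBm (q i); fun_prop)
  rcases isEmpty_or_nonempty ι with hι | hι
  · simp
  obtain ⟨e, he⟩ := exists_surjective_nat ι
  have h1 : ∀ ω, (⨆ i, ⨆ _ : (q i : ℝ) ≤ δ, ENNReal.ofReal (Real.exp (B (q i) ω ^ 2 / (8 * δ)))) =
      ⨆ N, ⨆ k ∈ Finset.range N, ⨆ _ : (q (e k) : ℝ) ≤ δ,
        ENNReal.ofReal (Real.exp (B (q (e k)) ω ^ 2 / (8 * δ))) := by
    intro ω
    rw [← he.iSup_comp]
    apply le_antisymm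
    · refine iSup_le fun k => le_iSup_of_le (k + 1) ?_
      exact le_iSup₂_of_le k (Finset.self_mem_range_succ k) le_rfl
    · exact iSup_le fun N => iSup₂_le fun k _ => le_iSup (fun k => ⨆ _ : (q (e k) : ℝ) ≤ δ,
        ENNReal.ofReal (Real.exp (B (q (e k)) ω ^ 2 / (8 * δ)))) k
  simp_rw [h1]
  rw [lintegral_iSup (f := fun N ω => ⨆ k ∈ Finset.range N, ⨆ _ : (q (e k) : ℝ) ≤ δ,
        ENNReal.ofReal (Real.exp (B (q (e k)) ω ^ 2 / (8 * δ))))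
    (fun N => Measurable.iSup fun k => Measurable.iSup_Prop _ (hm (e k)))
    (fun N N' h ω => biSup_mono fun k hk => Finset.range_mono h hk)]
  refine iSup_le fun N => ?_
  lift δ to ℝ≥0 using hδ.le
  obtain ⟨s, hs, hs0, hsδ, hsF⟩ := exists_monotone_seq_of_finset
    (((Finset.range N).image fun k => q (e k)).filter (· ≤ δ)) (δ := δ) (by simp)
  refine le_trans (lintegral_mono fun ω => ?_)
    (lintegral_iSup_exp_sq_brownian_seq_le hB hBm hB0 hδ hs hs0 fun n => by exact_mod_cast hsδ n)
  refine iSup₂_le fun k hk => iSup_le fun hkδ => ?_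
  obtain ⟨n, hn⟩ := hsF (q (e k)) (by
    simp only [Finset.mem_filter, Finset.mem_image]
    exact ⟨⟨k, hk, rfl⟩, by exact_mod_cast hkδ⟩)
  rw [← hn]
  exact le_iSup (fun n => ENNReal.ofReal (Real.exp (B (s n) ω ^ 2 / (8 * (δ : ℝ))))) n

end Brownian

noncomputable section

/-! ### Expected excess of an excursion within one time step. -/

section Excursion

/-- The excess over `1` of the exponential weight of an excursion within one time step: `R` is the
squared size of the state, `s` the elapsed time and `y` the squared size of the Brownian
increment. -/
def excursionExcess (lam b A R s y : ℝ) : ℝ :=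
  Real.exp (lam * (-(b / 2) * R * s + A * y / (s + 1 / R))) - 1

/-- The constant in the bound of the expected excess of an excursion. -/
def excursionConst (m : ℕ) (lam b : ℝ) : ℝ :=
  4 * m / ((1 - Real.exp (-(lam * b / 2))) * (1 - Real.exp (-(lam * b))))

theorem mul_one_sub_exp_neg_le {y r : ℝ} (hr0 : 0 ≤ r) (hr1 : r ≤ 1) :
    r * (1 - Real.exp (-y)) ≤ 1 - Real.exp (-(y * r)) := by
  have h := convexOn_exp.2 (Set.mem_univ (-y)) (Set.mem_univ 0) hr0 (sub_nonneg.2 hr1) (by ring)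
  simp only [smul_eq_mul, mul_zero, add_zero, Real.exp_zero, mul_one] at h
  rw [show r * -y = -(y * r) by ring] at h
  linarith

theorem exp_mul_sub_one_le {z r : ℝ} (hr0 : 0 ≤ r) (hr1 : r ≤ 1) :
    Real.exp (r * z) - 1 ≤ r * Real.exp z := by
  have h := convexOn_exp.2 (Set.mem_univ z) (Set.mem_univ 0) hr0 (sub_nonneg.2 hr1) (by ring)
  simp only [smul_eq_mul, mul_zero, add_zero, Real.exp_zero, mul_one] at h
  linarith

variable {m : ℕ} {lam b A : ℝ}

theorem exp_norm_sq_sub_one_le (w : Euc m) {κ : ℝ} (hκ : 0 ≤ κ) :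
    Real.exp (κ * ‖w‖ ^ 2) - 1 ≤ ∑ i, (Real.exp (m * κ * w i ^ 2) - 1) := by
  have := exp_sum_sub_one_le (fun i => κ * w i ^ 2) fun i => by positivity
  rw [← Finset.mul_sum] at this
  rw [EuclideanSpace.norm_sq_eq]
  simpa [mul_assoc] using this

/-- For R · De ≤ 1 the dissipation is simply dropped and s + 1/R is bounded below by 1/R. Convexity
of exp then extracts the factor R · De, so a short step costs proportionally little. -/
theorem excursionExcess_le_of_small (hlam : 0 < lam) (hb : 0 < b) (hA : 0 < A)
    (hmA : 8 * m * (lam * A) ≤ 1) {R De s : ℝ} (hR : 0 < R) (hDe : 0 < De) (hs : 0 ≤ s)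
    (hr : R * De ≤ 1) (w : Euc m) :
    excursionExcess lam b A R s (‖w‖ ^ 2) ≤ R * De * ∑ i, Real.exp (w i ^ 2 / (8 * De)) := by
  have h1 : lam * (-(b / 2) * R * s + A * ‖w‖ ^ 2 / (s + 1 / R)) ≤ lam * A * R * ‖w‖ ^ 2 := by
    have h2 : A * ‖w‖ ^ 2 / (s + 1 / R) ≤ A * ‖w‖ ^ 2 / (1 / R) :=
      div_le_div_of_nonneg_left (by positivity) (by positivity) (by linarith)
    have h3 : A * ‖w‖ ^ 2 / (1 / R) = A * R * ‖w‖ ^ 2 := by field_simp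
    have h4 : 0 ≤ b / 2 * R * s := by positivity
    have h5 : -(b / 2) * R * s + A * ‖w‖ ^ 2 / (s + 1 / R) ≤ A * R * ‖w‖ ^ 2 := by linarith
    calc _ ≤ lam * (A * R * ‖w‖ ^ 2) := mul_le_mul_of_nonneg_left h5 hlam.le
      _ = _ := by ring
  calc excursionExcess lam b A R s (‖w‖ ^ 2) ≤ Real.exp (lam * A * R * ‖w‖ ^ 2) - 1 :=
        sub_le_sub_right (Real.exp_le_exp.2 h1) 1
    _ ≤ ∑ i, (Real.exp (m * (lam * A * R) * w i ^ 2) - 1) :=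
        exp_norm_sq_sub_one_le w (by positivity)
    _ ≤ ∑ i, R * De * Real.exp (w i ^ 2 / (8 * De)) := by
        refine Finset.sum_le_sum fun i _ => ?_
        refine le_trans (sub_le_sub_right (Real.exp_le_exp.2 ?_) 1)
          (exp_mul_sub_one_le (z := w i ^ 2 / (8 * De)) (by positivity) hr)
        have e : R * De * (w i ^ 2 / (8 * De)) = R * w i ^ 2 * (1 / 8) := by field_simp
        rw [e, show m * (lam * A * R) * w i ^ 2 = R * w i ^ 2 * (m * (lam * A)) by ring]
        exact mul_le_mul_of_nonneg_left (by linarith) (by positivity)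
    _ = _ := by rw [Finset.mul_sum]

/-- For long steps time is measured in units of 1/R. By time j/R the dissipation has contributed a
factor exp(-λb/2)^j, and the denominator s + 1/R matches the Brownian scale of the interval [0, (j +
1)/R]. -/
theorem excursionExcess_le_of_floor (hlam : 0 < lam) (hb : 0 < b) (hA : 0 < A)
    (hmA : 8 * m * (lam * A) ≤ 1) {R s : ℝ} (hR : 0 < R) (hs : 0 ≤ s) (w : Euc m) {j : ℕ}
    (hj : (j : ℝ) ≤ s * R) :
    excursionExcess lam b A R s (‖w‖ ^ 2) ≤
      Real.exp (-(lam * b / 2)) ^ j * ∑ i, Real.exp (w i ^ 2 / (8 * ((j + 1) / R))) := by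
  have hsR : 0 < s + 1 / R := by positivity
  have hle : (j + 1) / R ≤ s + 1 / R := by
    rw [add_div]
    have : (j : ℝ) / R ≤ s := by rwa [div_le_iff₀ hR]
    linarith
  have e1 : Real.exp (lam * (-(b / 2) * R * s + A * ‖w‖ ^ 2 / (s + 1 / R))) =
      Real.exp (-(lam * b / 2 * (s * R))) * Real.exp (lam * A / (s + 1 / R) * ‖w‖ ^ 2) := by
    rw [← Real.exp_add]; congr 1; ring
  have h1 : Real.exp (-(lam * b / 2 * (s * R))) ≤ 1 := by
    rw [Real.exp_le_one_iff]
    have : 0 ≤ lam * b / 2 * (s * R) := by positivity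
    linarith
  have h2 : Real.exp (-(lam * b / 2 * (s * R))) ≤ Real.exp (-(lam * b / 2)) ^ j := by
    rw [← Real.exp_nat_mul]
    apply Real.exp_le_exp.2
    have : lam * b / 2 * j ≤ lam * b / 2 * (s * R) :=
      mul_le_mul_of_nonneg_left hj (by positivity)
    linarith
  have h3 : Real.exp (lam * A / (s + 1 / R) * ‖w‖ ^ 2) - 1 ≤
      ∑ i, Real.exp (w i ^ 2 / (8 * ((j + 1) / R))) := by
    refine (exp_norm_sq_sub_one_le w (by positivity)).trans (Finset.sum_le_sum fun i _ => ?_)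
    refine (sub_le_self _ zero_le_one).trans (Real.exp_le_exp.2 ?_)
    calc m * (lam * A / (s + 1 / R)) * w i ^ 2 = m * (lam * A) * w i ^ 2 / (s + 1 / R) := by ring
      _ ≤ 1 / 8 * w i ^ 2 / (s + 1 / R) := by gcongr; linarith
      _ ≤ 1 / 8 * w i ^ 2 / ((j + 1) / R) := by gcongr
      _ = _ := by field_simp
  have h0 : 0 ≤ Real.exp (lam * A / (s + 1 / R) * ‖w‖ ^ 2) - 1 := by
    have : 0 ≤ lam * A / (s + 1 / R) * ‖w‖ ^ 2 := by positivity
    linarith [Real.one_le_exp this]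
  calc excursionExcess lam b A R s (‖w‖ ^ 2)
      ≤ Real.exp (-(lam * b / 2 * (s * R))) *
          (Real.exp (lam * A / (s + 1 / R) * ‖w‖ ^ 2) - 1) := by
        rw [excursionExcess, e1]; linarith
    _ ≤ _ := mul_le_mul h2 h3 h0 (by positivity)

/-- The right side vanishes with the step and has exactly the form of the gain in the one-step
estimate, which is what lets the excursions of infinitely many steps be summed. -/
theorem lintegral_iSup_excursionExcess_le {Ω : Type*} {mΩ : MeasurableSpace Ω} {μ : Measure Ω}
    [IsProbabilityMeasure μ] (hlam : 0 < lam) (hb : 0 < b) (hA : 0 < A)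
    (hmA : 8 * m * (lam * A) ≤ 1) {R De : ℝ} (hR : 0 < R) (hDe : 0 < De)
    {w : ℝ≥0 → Ω → Euc m} (hw : ∀ i, IsPreBrownianReal (fun t ω => w t ω i) μ)
    (hwm : ∀ t, Measurable (w t)) (hw0 : ∀ ω, w 0 ω = 0) :
    ∫⁻ ω, ⨆ q : ℚ≥0, ⨆ _ : ((q : ℝ≥0) : ℝ) ≤ De,
        ENNReal.ofReal (excursionExcess lam b A R (q : ℝ≥0) (‖w q ω‖ ^ 2)) ∂μ ≤
      ENNReal.ofReal (excursionConst m lam b * (1 - Real.exp (-(lam * b * (R * De))))) := by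
  have hwim : ∀ i t, Measurable fun ω => w t ω i := fun i t => by
    have := hwm t; fun_prop
  have hsup : ∀ i {δ : ℝ}, 0 < δ → ∫⁻ ω, ⨆ q : ℚ≥0, ⨆ _ : ((q : ℝ≥0) : ℝ) ≤ δ,
      ENNReal.ofReal (Real.exp (w q ω i ^ 2 / (8 * δ))) ∂μ ≤ 4 := fun i δ hδ =>
    lintegral_iSup_exp_sq_brownian_le (hw i) (hwim i) (fun ω => by simp [hw0]) hδ
      (fun q : ℚ≥0 => (q : ℝ≥0))
  have hsupm : ∀ i (δ : ℝ), Measurable fun ω => ⨆ q : ℚ≥0, ⨆ _ : ((q : ℝ≥0) : ℝ) ≤ δ,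
      ENNReal.ofReal (Real.exp (w q ω i ^ 2 / (8 * δ))) := fun i δ =>
    Measurable.iSup fun q => Measurable.iSup_Prop _ (by have := hwim i q; fun_prop)
  have hx : Real.exp (-(lam * b / 2)) < 1 := by
    rw [Real.exp_lt_one_iff]; have : 0 < lam * b / 2 := by positivity
    linarith
  have hy : Real.exp (-(lam * b)) < 1 := by
    rw [Real.exp_lt_one_iff]; have : 0 < lam * b := by positivity
    linarith
  have hx0 := Real.exp_pos (-(lam * b / 2))
  -- If R · De ≤ 1, the bound 4m · R · De is compared with 1 - exp(-λb R De) by concavity. Otherwise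
  -- that factor is at least 1 - exp(-λb), and the unit slices of time are summed as a geometric
  -- series.
  rcases le_or_gt (R * De) 1 with hr | hr
  · calc ∫⁻ ω, ⨆ q : ℚ≥0, ⨆ _ : ((q : ℝ≥0) : ℝ) ≤ De,
          ENNReal.ofReal (excursionExcess lam b A R (q : ℝ≥0) (‖w q ω‖ ^ 2)) ∂μ
        ≤ ∫⁻ ω, ENNReal.ofReal (R * De) * ∑ i, ⨆ q : ℚ≥0, ⨆ _ : ((q : ℝ≥0) : ℝ) ≤ De,
            ENNReal.ofReal (Real.exp (w q ω i ^ 2 / (8 * De))) ∂μ := by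
          refine lintegral_mono fun ω => iSup₂_le fun q hq => ?_
          refine (ENNReal.ofReal_le_ofReal (excursionExcess_le_of_small hlam hb hA hmA hR hDe
            (NNReal.coe_nonneg _) hr _)).trans ?_
          rw [ENNReal.ofReal_mul (by positivity), ENNReal.ofReal_sum_of_nonneg
            (fun i _ => (Real.exp_pos _).le)]
          gcongr with i
          exact le_iSup₂_of_le q hq le_rfl
      _ = ENNReal.ofReal (R * De) * ∑ i, ∫⁻ ω, ⨆ q : ℚ≥0, ⨆ _ : ((q : ℝ≥0) : ℝ) ≤ De,
            ENNReal.ofReal (Real.exp (w q ω i ^ 2 / (8 * De))) ∂μ := by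
          rw [lintegral_const_mul _ (Finset.measurable_fun_sum _ fun i _ => hsupm i De),
            lintegral_finsetSum _ fun i _ => hsupm i De]
      _ ≤ ENNReal.ofReal (R * De) * ∑ i : Fin m, 4 := by
          gcongr with i; exact hsup i hDe
      _ = ENNReal.ofReal (4 * m * (R * De)) := by
          rw [Finset.sum_const, Finset.card_univ, Fintype.card_fin, nsmul_eq_mul,
            ← ENNReal.ofReal_natCast, ← ENNReal.ofReal_ofNat, ← ENNReal.ofReal_mul (by positivity),
            ← ENNReal.ofReal_mul (by positivity)]
          congr 1; ring
      _ ≤ _ := by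
          apply ENNReal.ofReal_le_ofReal
          have h1 := mul_one_sub_exp_neg_le (y := lam * b) (by positivity : 0 ≤ R * De) hr
          rw [excursionConst, div_mul_eq_mul_div, le_div_iff₀ (mul_pos (by linarith) (by linarith))]
          calc 4 * (m : ℝ) * (R * De) *
                ((1 - Real.exp (-(lam * b / 2))) * (1 - Real.exp (-(lam * b))))
              ≤ 4 * (m : ℝ) * (R * De) * (1 * (1 - Real.exp (-(lam * b)))) := by
                (gcongr; linarith)
            _ = 4 * m * (R * De * (1 - Real.exp (-(lam * b)))) := by ring
            _ ≤ _ := by gcongr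
  · calc ∫⁻ ω, ⨆ q : ℚ≥0, ⨆ _ : ((q : ℝ≥0) : ℝ) ≤ De,
          ENNReal.ofReal (excursionExcess lam b A R (q : ℝ≥0) (‖w q ω‖ ^ 2)) ∂μ
        ≤ ∫⁻ ω, ∑' j : ℕ, ENNReal.ofReal (Real.exp (-(lam * b / 2))) ^ j *
            ∑ i, ⨆ q : ℚ≥0, ⨆ _ : ((q : ℝ≥0) : ℝ) ≤ (j + 1) / R,
              ENNReal.ofReal (Real.exp (w q ω i ^ 2 / (8 * ((j + 1) / R)))) ∂μ := by
          refine lintegral_mono fun ω => iSup₂_le fun q hq => ?_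
          set j := ⌊((q : ℝ≥0) : ℝ) * R⌋₊ with hj
          have hj1 : (j : ℝ) ≤ ((q : ℝ≥0) : ℝ) * R := Nat.floor_le (by positivity)
          have hj2 : ((q : ℝ≥0) : ℝ) ≤ (j + 1) / R := by
            rw [le_div_iff₀ hR]; exact (Nat.lt_floor_add_one _).le
          refine le_trans ?_ (ENNReal.le_tsum j)
          refine (ENNReal.ofReal_le_ofReal (excursionExcess_le_of_floor hlam hb hA hmA hR
            (NNReal.coe_nonneg _) _ hj1)).trans ?_
          rw [ENNReal.ofReal_mul (by positivity), ENNReal.ofReal_sum_of_nonneg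
            (fun i _ => (Real.exp_pos _).le), ENNReal.ofReal_pow hx0.le]
          gcongr with i
          exact le_iSup₂_of_le q hj2 le_rfl
      _ = ∑' j : ℕ, ENNReal.ofReal (Real.exp (-(lam * b / 2))) ^ j *
            ∑ i, ∫⁻ ω, ⨆ q : ℚ≥0, ⨆ _ : ((q : ℝ≥0) : ℝ) ≤ (j + 1) / R,
              ENNReal.ofReal (Real.exp (w q ω i ^ 2 / (8 * ((j + 1) / R)))) ∂μ := by
          rw [lintegral_tsum fun j => (Measurable.const_mul
            (Finset.measurable_fun_sum _ fun i _ => hsupm i _) _).aemeasurable]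
          congr 1; ext j
          rw [lintegral_const_mul _ (Finset.measurable_fun_sum _ fun i _ => hsupm i _),
            lintegral_finsetSum _ fun i _ => hsupm i _]
      _ ≤ ∑' j : ℕ, ENNReal.ofReal (Real.exp (-(lam * b / 2))) ^ j * ∑ i : Fin m, 4 := by
          gcongr with j i; exact hsup i (by positivity)
      _ = ENNReal.ofReal (4 * m / (1 - Real.exp (-(lam * b / 2)))) := by
          rw [ENNReal.tsum_mul_right, ENNReal.tsum_geometric, Finset.sum_const, Finset.card_univ,
            Fintype.card_fin, nsmul_eq_mul, ← ENNReal.ofReal_natCast, ← ENNReal.ofReal_ofNat,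
            ← ENNReal.ofReal_one, ← ENNReal.ofReal_sub _ hx0.le,
            ← ENNReal.ofReal_inv_of_pos (by linarith), ← ENNReal.ofReal_mul (by positivity),
            ← ENNReal.ofReal_mul (inv_nonneg.2 (by linarith))]
          congr 1; field_simp
      _ ≤ _ := by
          apply ENNReal.ofReal_le_ofReal
          have h1 : Real.exp (-(lam * b * (R * De))) ≤ Real.exp (-(lam * b)) := by
            apply Real.exp_le_exp.2
            have : lam * b * 1 ≤ lam * b * (R * De) :=
              mul_le_mul_of_nonneg_left hr.le (by positivity)
            linarith
          rw [excursionConst, ← div_div, div_mul_eq_mul_div, le_div_iff₀ (by linarith)]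
          have h2 : 0 ≤ 4 * (m : ℝ) / (1 - Real.exp (-(lam * b / 2))) :=
            div_nonneg (by positivity) (by linarith)
          exact mul_le_mul_of_nonneg_left (by linarith) h2

end Excursion


/-! ### Deterministic step estimates and the one-step exponential moment. -/

namespace AdaptiveScheme

variable {m : ℕ} {S : AdaptiveScheme m} {α β B : ℝ}

/-- The standing assumptions on the scheme. -/
structure Admissible (S : AdaptiveScheme m) (α β B : ℝ) : Prop where
  continuous_drift : Continuous S.drift
  continuous_diffusion : Continuous S.diffusion
  α_pos : 0 < α
  coercive : ∀ x : Euc m, inner ℝ (S.drift x) x ≤ α - β * ‖x‖ ^ 2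
  one_le : 1 ≤ B
  bound : ∀ x : Euc m, ‖S.diffusion x‖ ≤ B
  tol_pos : 0 < S.tol
  tol_lt : S.tol < 2 * β
  maxStep_pos : 0 < S.maxStep

/-- The contraction rate of the squared norm under the scheme. -/
def rate (S : AdaptiveScheme m) (β : ℝ) : ℝ :=
  (2 * β - S.tol) / (2 * (1 + (2 * β - S.tol) * S.maxStep))

/-- The shift that makes the squared norm dominate the additive constants. -/
def shift (S : AdaptiveScheme m) (α : ℝ) : ℝ := 1 + (2 * α + S.tol) * S.maxStep

/-- The shifted squared norm. -/
def sizeSq (S : AdaptiveScheme m) (α : ℝ) (x : Euc m) : ℝ := ‖x‖ ^ 2 + S.shift α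

/-- The growth rate of the exponential moments. -/
def growth (S : AdaptiveScheme m) (α β B : ℝ) : ℝ :=
  2 * α + S.tol + S.rate β * S.shift α + 2 * m ^ 2 * B ^ 2

/-- The coefficient of the squared Brownian increment in the bound of an excursion. -/
def noiseConst (S : AdaptiveScheme m) (β B : ℝ) : ℝ :=
  2 * B ^ 2 / S.rate β + B ^ 2 * (S.maxStep + 1)

namespace Admissible

theorem gap_pos (h : S.Admissible α β B) : 0 < 2 * β - S.tol := sub_pos.2 h.tol_lt

theorem rate_pos (h : S.Admissible α β B) : 0 < S.rate β := by
  have := h.gap_pos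
  have := h.maxStep_pos
  unfold rate; positivity

theorem B_pos (h : S.Admissible α β B) : 0 < B := zero_lt_one.trans_le h.one_le

theorem offset_pos (h : S.Admissible α β B) : 0 < 2 * α + S.tol := by
  linarith [h.α_pos, h.tol_pos]

theorem one_le_shift (h : S.Admissible α β B) : 1 ≤ S.shift α := by
  have := mul_pos h.offset_pos h.maxStep_pos
  unfold shift; linarith

theorem one_le_sizeSq (h : S.Admissible α β B) (x : Euc m) : 1 ≤ S.sizeSq α x := by
  have := h.one_le_shift
  unfold sizeSq; nlinarith [sq_nonneg ‖x‖]

theorem sizeSq_pos (h : S.Admissible α β B) (x : Euc m) : 0 < S.sizeSq α x :=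
  zero_lt_one.trans_le (h.one_le_sizeSq x)

theorem growth_pos (h : S.Admissible α β B) : 0 < S.growth α β B := by
  have := h.offset_pos
  have := h.rate_pos
  have := zero_lt_one.trans_le h.one_le_shift
  unfold growth; positivity

theorem noiseConst_pos (h : S.Admissible α β B) : 0 < S.noiseConst β B := by
  have := h.B_pos
  have := h.rate_pos
  have := h.maxStep_pos
  unfold noiseConst; positivity

theorem stepSize_pos (h : S.Admissible α β B) (k : ℕ) : 0 < S.stepSize k :=
  div_pos h.maxStep_pos (by positivity)

theorem stepSize_le (h : S.Admissible α β B) (k : ℕ) : S.stepSize k ≤ S.maxStep :=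
  div_le_self h.maxStep_pos.le (one_le_pow₀ one_le_two)

theorem stepSize_antitone (h : S.Admissible α β B) : Antitone S.stepSize := fun _ _ hij =>
  div_le_div_of_nonneg_left h.maxStep_pos.le (by positivity) (pow_le_pow_right₀ one_le_two hij)

theorem tendsto_stepSize (S : AdaptiveScheme m) :
    Filter.Tendsto S.stepSize Filter.atTop (nhds 0) :=
  Filter.Tendsto.const_div_atTop (tendsto_pow_atTop_atTop_of_one_lt one_lt_two) _

/-- On bounded sets the tolerance is met by all sufficiently small steps. -/
theorem exists_forall_tol (h : S.Admissible α β B) (r : ℝ) :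
    ∃ k₀ : ℕ, ∀ k, k₀ ≤ k → ∀ x : Euc m, ‖x‖ ≤ r →
      ‖S.drift (S.eulerMap x (S.stepSize k)) - S.drift x‖ ≤ S.tol := by
  have hc : Continuous fun p : ℝ × Euc m => S.drift (S.eulerMap p.2 p.1) - S.drift p.2 := by
    have := h.continuous_drift
    unfold eulerMap; fun_prop
  have hopen : IsOpen {p : ℝ × Euc m | ‖S.drift (S.eulerMap p.2 p.1) - S.drift p.2‖ < S.tol} :=
    isOpen_lt hc.norm continuous_const
  obtain ⟨u, v, hu, -, h0u, hv, huv⟩ := generalized_tube_lemma (s := {(0 : ℝ)})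
    isCompact_singleton (isCompact_closedBall (0 : Euc m) r) hopen (by
      rintro ⟨t, x⟩ ⟨ht, -⟩
      simp only [Set.mem_singleton_iff] at ht
      simp [ht, eulerMap, h.tol_pos])
  have hev := (tendsto_stepSize S).eventually (hu.mem_nhds (h0u rfl))
  obtain ⟨k₀, hk₀⟩ := Filter.eventually_atTop.1 hev
  refine ⟨k₀, fun k hk x hx => ?_⟩
  have := huv (Set.mk_mem_prod (hk₀ k hk) (hv (by simpa using hx)))
  exact le_of_lt this

theorem stepExponent_spec (h : S.Admissible α β B) (x : Euc m) (l : ℕ) :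
    ‖S.drift (S.eulerMap x (S.stepSize (S.stepExponent x l))) - S.drift x‖ ≤ S.tol ∧
      l ≤ S.stepExponent x l + 1 := by
  obtain ⟨k₀, hk₀⟩ := h.exists_forall_tol ‖x‖
  exact Nat.sInf_mem (s := {k : ℕ | ‖S.drift (S.eulerMap x (S.stepSize k)) - S.drift x‖ ≤ S.tol ∧
    l ≤ k + 1}) ⟨max k₀ l, hk₀ _ (le_max_left _ _) x le_rfl, by
      have := le_max_right k₀ l; omega⟩

theorem stepExponent_le (r : ℝ) {k₀ : ℕ}
    (hk₀ : ∀ k, k₀ ≤ k → ∀ x : Euc m, ‖x‖ ≤ r →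
      ‖S.drift (S.eulerMap x (S.stepSize k)) - S.drift x‖ ≤ S.tol) {x : Euc m} (hx : ‖x‖ ≤ r)
    (l : ℕ) : S.stepExponent x l ≤ max k₀ l :=
  Nat.sInf_le ⟨hk₀ _ (le_max_left _ _) x hx, by have := le_max_right k₀ l; omega⟩

/-- The implicit-type dissipation estimate for one Euler drift step. -/
theorem norm_eulerMap_sq_mul_le (h : S.Admissible α β B) {x : Euc m} {Δ : ℝ} (hΔ : 0 ≤ Δ)
    (htol : ‖S.drift (S.eulerMap x Δ) - S.drift x‖ ≤ S.tol) :
    ‖S.eulerMap x Δ‖ ^ 2 * (1 + Δ * (2 * β - S.tol)) ≤ ‖x‖ ^ 2 + Δ * (2 * α + S.tol) := by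
  set H := S.eulerMap x Δ with hH
  -- The expansion is made around the endpoint H, where coercivity will be used. The term Δ²|f(x)|²
  -- then comes with the favourable sign and is discarded, so no growth bound on f is needed.
  have hx : x = H - Δ • S.drift x := by rw [hH, eulerMap]; abel
  have h1 : ‖x‖ ^ 2 = ‖H‖ ^ 2 - 2 * Δ * inner ℝ (S.drift x) H + Δ ^ 2 * ‖S.drift x‖ ^ 2 := by
    conv_lhs => rw [hx]
    rw [norm_sub_sq_real, inner_smul_right, norm_smul, mul_pow, Real.norm_eq_abs, sq_abs,
      real_inner_comm]
    ring
  have h2 : inner ℝ (S.drift x) H ≤ α - β * ‖H‖ ^ 2 + S.tol * ‖H‖ := by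
    have e : inner ℝ (S.drift x) H =
        inner ℝ (S.drift H) H - inner ℝ (S.drift H - S.drift x) H := by
      rw [inner_sub_left]; ring
    have h3 := abs_le.1 (abs_real_inner_le_norm (S.drift H - S.drift x) H)
    have h4 := mul_le_mul_of_nonneg_right htol (norm_nonneg H)
    linarith [h.coercive H, h3.1]
  have h5 : 2 * ‖H‖ ≤ 1 + ‖H‖ ^ 2 := by nlinarith [sq_nonneg (‖H‖ - 1)]
  have h6 : 2 * inner ℝ (S.drift x) H ≤ 2 * α + S.tol - (2 * β - S.tol) * ‖H‖ ^ 2 := by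
    nlinarith [h.tol_pos]
  have h7 := mul_le_mul_of_nonneg_left h6 hΔ
  have h8 : 0 ≤ Δ ^ 2 * ‖S.drift x‖ ^ 2 := by positivity
  nlinarith

/-- Half of the dissipation stays on the left, to absorb the Gaussian cross term. The other half
becomes the contraction of |x|². -/
theorem norm_eulerMap_sq_mul_le' (h : S.Admissible α β B) {x : Euc m} {Δ : ℝ} (hΔ : 0 ≤ Δ)
    (hΔ' : Δ ≤ S.maxStep) (htol : ‖S.drift (S.eulerMap x Δ) - S.drift x‖ ≤ S.tol) :
    ‖S.eulerMap x Δ‖ ^ 2 * (1 + Δ * (2 * β - S.tol) / 2) ≤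
      (1 - S.rate β * Δ) * ‖x‖ ^ 2 + Δ * (2 * α + S.tol) := by
  have h0 := h.norm_eulerMap_sq_mul_le hΔ htol
  have hg := h.gap_pos
  have ho := h.offset_pos
  have hD := h.maxStep_pos
  set g := 2 * β - S.tol
  set q := 1 - S.rate β * Δ with hq
  have hpos : 0 < 1 + Δ * g := by positivity
  -- This inequality dictates `rate`: it needs rate · (1 + Δg) ≤ g/2 for every Δ ≤ Δ_max.
  have h1 : 1 + Δ * g / 2 ≤ q * (1 + Δ * g) := by
    have : S.rate β * (1 + Δ * g) ≤ g / 2 := by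
      have e : g / 2 = S.rate β * (1 + g * S.maxStep) := by
        have : 1 + g * S.maxStep ≠ 0 := by positivity
        change g / 2 = g / (2 * (1 + g * S.maxStep)) * (1 + g * S.maxStep)
        field_simp
      rw [e]
      apply mul_le_mul_of_nonneg_left _ h.rate_pos.le
      nlinarith
    rw [hq]
    nlinarith [mul_le_mul_of_nonneg_left this hΔ]
  have hq0 : 0 ≤ q := by
    by_contra hcon
    have := mul_neg_of_neg_of_pos (not_le.1 hcon) hpos
    have : 0 ≤ Δ * g := by positivity
    linarith
  have hq1 : q ≤ 1 := by
    have := mul_nonneg h.rate_pos.le hΔ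
    rw [hq]; linarith
  calc ‖S.eulerMap x Δ‖ ^ 2 * (1 + Δ * g / 2) ≤ ‖S.eulerMap x Δ‖ ^ 2 * (q * (1 + Δ * g)) := by
        gcongr
    _ = q * (‖S.eulerMap x Δ‖ ^ 2 * (1 + Δ * g)) := by ring
    _ ≤ q * (‖x‖ ^ 2 + Δ * (2 * α + S.tol)) := by gcongr
    _ ≤ q * ‖x‖ ^ 2 + Δ * (2 * α + S.tol) := by
        have : 0 ≤ Δ * (2 * α + S.tol) := by positivity
        nlinarith

theorem norm_eulerMap_sq_le (h : S.Admissible α β B) {x : Euc m} {Δ : ℝ} (hΔ : 0 ≤ Δ)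
    (hΔ' : Δ ≤ S.maxStep) (htol : ‖S.drift (S.eulerMap x Δ) - S.drift x‖ ≤ S.tol) :
    ‖S.eulerMap x Δ‖ ^ 2 ≤ (1 - S.rate β * Δ) * ‖x‖ ^ 2 + Δ * (2 * α + S.tol) := by
  refine le_trans ?_ (h.norm_eulerMap_sq_mul_le' hΔ hΔ' htol)
  have := h.gap_pos
  apply le_mul_of_one_le_right (sq_nonneg _)
  have : 0 ≤ Δ * (2 * β - S.tol) := by positivity
  linarith

/-- The exponential moment of one step of the scheme. -/
theorem lintegral_exp_step_le (h : S.Admissible α β B) {lam : ℝ} (hlam : 0 < lam)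
    (h1 : 8 * lam * B ^ 2 ≤ 2 * β - S.tol) (h2 : 8 * m * lam * B ^ 2 * S.maxStep ≤ 1)
    {x : Euc m} {Δ : ℝ} (hΔ : 0 ≤ Δ) (hΔ' : Δ ≤ S.maxStep)
    (htol : ‖S.drift (S.eulerMap x Δ) - S.drift x‖ ≤ S.tol) :
    ∫⁻ z, ENNReal.ofReal (Real.exp (lam * ‖S.eulerMap x Δ + √Δ • S.diffusion x z‖ ^ 2))
        ∂(stdGaussian (Euc m)) ≤
      ENNReal.ofReal (Real.exp (lam * (‖x‖ ^ 2 - S.rate β * (S.sizeSq α x * Δ) +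
        S.growth α β B * Δ))) := by
  set H := S.eulerMap x Δ with hH
  set L := S.diffusion x with hL
  have hB := h.B_pos
  have hsq : √Δ ^ 2 = Δ := Real.sq_sqrt hΔ
  -- With this v the cross term 2λ√Δ⟨H, Lz⟩ equals ⟨v, z⟩/2. Cauchy–Schwarz will separate it from
  -- the term quadratic in z, doubling both exponents.
  set v : Euc m := (4 * lam * √Δ) • ContinuousLinearMap.adjoint L H with hv
  have hLB : ‖L‖ ≤ B := h.bound x
  have hvn : ‖v‖ ^ 2 ≤ 16 * lam ^ 2 * Δ * B ^ 2 * ‖H‖ ^ 2 := by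
    have e1 : ‖ContinuousLinearMap.adjoint L H‖ ≤ B * ‖H‖ := by
      refine (ContinuousLinearMap.le_opNorm _ _).trans ?_
      rw [LinearIsometryEquiv.norm_map]
      gcongr
    have e2 : ‖v‖ ≤ 4 * lam * √Δ * (B * ‖H‖) := by
      rw [hv, norm_smul, Real.norm_eq_abs, abs_of_nonneg (by positivity)]
      gcongr
    calc ‖v‖ ^ 2 ≤ (4 * lam * √Δ * (B * ‖H‖)) ^ 2 := by gcongr
      _ = 16 * lam ^ 2 * √Δ ^ 2 * B ^ 2 * ‖H‖ ^ 2 := by ring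
      _ = _ := by rw [hsq]
  have hpt : ∀ z : Euc m, lam * ‖H + √Δ • L z‖ ^ 2 ≤
      lam * ‖H‖ ^ 2 + (inner ℝ v z / 2 + lam * Δ * B ^ 2 * ‖z‖ ^ 2) := by
    intro z
    have e1 : inner ℝ v z = 4 * lam * (√Δ * inner ℝ H (L z)) := by
      rw [hv, inner_smul_left, ContinuousLinearMap.adjoint_inner_left]
      simp; ring
    have e2 : ‖L z‖ ^ 2 ≤ B ^ 2 * ‖z‖ ^ 2 := by
      rw [← mul_pow]
      gcongr
      exact (L.le_opNorm z).trans (by gcongr)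
    have e3 : lam * (Δ * ‖L z‖ ^ 2) ≤ lam * (Δ * (B ^ 2 * ‖z‖ ^ 2)) := by gcongr
    rw [norm_add_sq_real, inner_smul_right, norm_smul, mul_pow, Real.norm_eq_abs, sq_abs, hsq, e1]
    nlinarith
  let F : Euc m → ENNReal := fun z => ENNReal.ofReal (Real.exp (inner ℝ v z / 2))
  let G : Euc m → ENNReal := fun z => ENNReal.ofReal (Real.exp (lam * Δ * B ^ 2 * ‖z‖ ^ 2))
  have hFm : AEMeasurable F (stdGaussian (Euc m)) := by
    refine Measurable.aemeasurable ?_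
    fun_prop
  have hGm : AEMeasurable G (stdGaussian (Euc m)) := by
    refine Measurable.aemeasurable ?_
    fun_prop
  have hF2 : (∫⁻ z, F z ^ (2 : ℝ) ∂(stdGaussian (Euc m))) ^ (1 / (2 : ℝ)) ≤
      ENNReal.ofReal (Real.exp (4 * lam ^ 2 * Δ * B ^ 2 * ‖H‖ ^ 2)) := by
    have e : ∀ z, F z ^ (2 : ℝ) = ENNReal.ofReal (Real.exp (inner ℝ v z)) := by
      intro z
      simp only [F]
      rw [ENNReal.ofReal_rpow_of_pos (Real.exp_pos _), ← Real.exp_mul]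
      congr 2; ring
    simp_rw [e]
    rw [lintegral_exp_inner_stdGaussian, ENNReal.ofReal_rpow_of_pos (Real.exp_pos _),
      ← Real.exp_mul]
    apply ENNReal.ofReal_le_ofReal
    apply Real.exp_le_exp.2
    linarith
  have hG2 : (∫⁻ z, G z ^ (2 : ℝ) ∂(stdGaussian (Euc m))) ^ (1 / (2 : ℝ)) ≤
      ENNReal.ofReal (Real.exp (2 * m ^ 2 * B ^ 2 * (lam * Δ))) := by
    have e : ∀ z, G z ^ (2 : ℝ) =
        ENNReal.ofReal (Real.exp (2 * lam * Δ * B ^ 2 * ‖z‖ ^ 2)) := by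
      intro z
      simp only [G]
      rw [ENNReal.ofReal_rpow_of_pos (Real.exp_pos _), ← Real.exp_mul]
      congr 2; ring
    simp_rw [e]
    have hp : 4 * m * (2 * lam * Δ * B ^ 2) ≤ 1 := by
      refine le_trans ?_ h2
      calc 4 * m * (2 * lam * Δ * B ^ 2) = 8 * m * lam * B ^ 2 * Δ := by ring
        _ ≤ _ := by gcongr
    refine (ENNReal.rpow_le_rpow (lintegral_exp_norm_sq_stdGaussian_le (by positivity) hp)
      (by norm_num)).trans ?_
    rw [ENNReal.ofReal_rpow_of_pos (Real.exp_pos _), ← Real.exp_mul]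
    apply ENNReal.ofReal_le_ofReal
    apply Real.exp_le_exp.2
    apply le_of_eq; ring
  calc ∫⁻ z, ENNReal.ofReal (Real.exp (lam * ‖H + √Δ • L z‖ ^ 2)) ∂(stdGaussian (Euc m))
      ≤ ∫⁻ z, ENNReal.ofReal (Real.exp (lam * ‖H‖ ^ 2)) * (F * G) z ∂(stdGaussian (Euc m)) := by
        refine lintegral_mono fun z => ?_
        simp only [Pi.mul_apply, F, G]
        rw [← ENNReal.ofReal_mul (Real.exp_pos _).le, ← ENNReal.ofReal_mul (Real.exp_pos _).le,
          ← Real.exp_add, ← Real.exp_add]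
        exact ENNReal.ofReal_le_ofReal (Real.exp_le_exp.2 (hpt z))
    _ = ENNReal.ofReal (Real.exp (lam * ‖H‖ ^ 2)) * ∫⁻ z, (F * G) z ∂(stdGaussian (Euc m)) :=
        lintegral_const_mul'' _ (hFm.mul hGm)
    _ ≤ ENNReal.ofReal (Real.exp (lam * ‖H‖ ^ 2)) *
          (ENNReal.ofReal (Real.exp (4 * lam ^ 2 * Δ * B ^ 2 * ‖H‖ ^ 2)) *
            ENNReal.ofReal (Real.exp (2 * m ^ 2 * B ^ 2 * (lam * Δ)))) := by
        gcongr
        exact (ENNReal.lintegral_mul_le_Lp_mul_Lq _ Real.HolderConjugate.two_two hFm hGm).trans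
          (mul_le_mul' hF2 hG2)
    _ = ENNReal.ofReal (Real.exp (lam * ‖H‖ ^ 2 + (4 * lam ^ 2 * Δ * B ^ 2 * ‖H‖ ^ 2 +
          2 * m ^ 2 * B ^ 2 * (lam * Δ)))) := by
        rw [← ENNReal.ofReal_mul (Real.exp_pos _).le, ← ENNReal.ofReal_mul (Real.exp_pos _).le,
          ← Real.exp_add, ← Real.exp_add]
    _ ≤ _ := by
        apply ENNReal.ofReal_le_ofReal
        apply Real.exp_le_exp.2
        have e1 := h.norm_eulerMap_sq_mul_le' hΔ hΔ' htol
        rw [← hH] at e1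
        -- The first smallness condition on `lam`: the variance of the cross term is paid for by the
        -- dissipation kept on the left.
        have e2 : 4 * lam * B ^ 2 * (Δ * ‖H‖ ^ 2) ≤ (2 * β - S.tol) / 2 * (Δ * ‖H‖ ^ 2) := by
          gcongr; linarith
        have e3 : lam * (‖H‖ ^ 2 + 4 * lam * B ^ 2 * (Δ * ‖H‖ ^ 2)) ≤
            lam * ((1 - S.rate β * Δ) * ‖x‖ ^ 2 + Δ * (2 * α + S.tol)) := by
          apply mul_le_mul_of_nonneg_left _ hlam.le
          linarith
        unfold sizeSq growth
        linarith

/-- Pathwise bound of the interpolated solution within one time step. -/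
theorem norm_interp_sq_le (h : S.Admissible α β B) {x : Euc m} {Δ : ℝ} (hΔ : 0 < Δ)
    (hΔ' : Δ ≤ S.maxStep) (htol : ‖S.drift (S.eulerMap x Δ) - S.drift x‖ ≤ S.tol)
    {s : ℝ} (hs : 0 ≤ s) (hsΔ : s ≤ Δ) (w : Euc m) :
    ‖S.eulerMap x s + S.diffusion x w‖ ^ 2 ≤ ‖x‖ ^ 2 + S.growth α β B * s + S.rate β / 2 +
      (-(S.rate β / 2) * S.sizeSq α x * s +
        S.noiseConst β B * ‖w‖ ^ 2 / (s + 1 / S.sizeSq α x)) := by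
  have hb := h.rate_pos
  have hB := h.B_pos
  have hR1 := h.one_le_sizeSq x
  have hR := h.sizeSq_pos x
  have ho := h.offset_pos
  have hD := h.maxStep_pos
  set b := S.rate β with hbdef
  set R := S.sizeSq α x with hRdef
  have hE : ‖S.eulerMap x s‖ ^ 2 ≤ ‖x‖ ^ 2 - b * s * ‖x‖ ^ 2 + s * (2 * α + S.tol) := by
    -- The tolerance was tested only at the full step Δ, not at s. Convexity of the squared norm
    -- along the segment carries the estimate over to intermediate times.
    have e : S.eulerMap x s = (1 - s / Δ) • x + (s / Δ) • S.eulerMap x Δ := by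
      simp only [eulerMap, smul_add, smul_smul, sub_smul, one_smul]
      rw [div_mul_cancel₀ _ hΔ.ne']; abel
    have hθ0 : 0 ≤ s / Δ := by positivity
    have hθ1 : 0 ≤ 1 - s / Δ := sub_nonneg.2 ((div_le_one hΔ).2 hsΔ)
    have e1 : ‖S.eulerMap x s‖ ≤ (1 - s / Δ) * ‖x‖ + s / Δ * ‖S.eulerMap x Δ‖ := by
      rw [e]
      refine (norm_add_le _ _).trans_eq ?_
      rw [norm_smul, norm_smul, Real.norm_of_nonneg hθ0, Real.norm_of_nonneg hθ1]
    have e2 : ‖S.eulerMap x s‖ ^ 2 ≤ (1 - s / Δ) * ‖x‖ ^ 2 + s / Δ * ‖S.eulerMap x Δ‖ ^ 2 := by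
      refine (pow_le_pow_left₀ (norm_nonneg _) e1 2).trans ?_
      nlinarith [mul_nonneg (mul_nonneg hθ0 hθ1) (sq_nonneg (‖x‖ - ‖S.eulerMap x Δ‖))]
    have e3 := mul_le_mul_of_nonneg_left (h.norm_eulerMap_sq_le hΔ.le hΔ' htol) hθ0
    have e4 : s / Δ * ((1 - b * Δ) * ‖x‖ ^ 2 + Δ * (2 * α + S.tol)) =
        s / Δ * ‖x‖ ^ 2 - b * s * ‖x‖ ^ 2 + s * (2 * α + S.tol) := by
      field_simp
    rw [← hbdef] at e3
    linarith
  -- This is why `shift` contains (2α + τ)Δ_max. Its summand 1 makes R ≥ 1.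
  have hER : ‖S.eulerMap x s‖ ^ 2 ≤ R := by
    have : 0 ≤ b * s * ‖x‖ ^ 2 := by positivity
    have : s * (2 * α + S.tol) ≤ S.maxStep * (2 * α + S.tol) := by gcongr; linarith
    rw [hRdef, sizeSq, shift]
    linarith
  have hL : ‖S.diffusion x w‖ ≤ B * ‖w‖ :=
    ((S.diffusion x).le_opNorm w).trans (by gcongr; exact h.bound x)
  have hsR : 0 < s + 1 / R := by positivity
  -- Young's inequality with weight (b/2)(Rs + 1). It uses half of the dissipation bRs and leaves
  -- the constant b/2. The + 1 keeps the denominator s + 1/R positive at s = 0.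
  have hcross : 2 * (‖S.eulerMap x s‖ * (B * ‖w‖)) ≤
      b / 2 * (R * s + 1) + 2 * B ^ 2 / b * ‖w‖ ^ 2 / (s + 1 / R) := by
    have e0 : ‖S.eulerMap x s‖ ≤ √R := Real.le_sqrt_of_sq_le hER
    have e1 : b / 2 * (R * s + 1) + 2 * B ^ 2 / b * ‖w‖ ^ 2 / (s + 1 / R) -
        2 * (√R * (B * ‖w‖)) =
        (b / 2 * (R * s + 1) - √R * B * ‖w‖) ^ 2 / (b / 2 * (R * s + 1)) := by
      have e2 : √R ^ 2 = R := Real.sq_sqrt hR.le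
      have : R * s + 1 ≠ 0 := by positivity
      have e3 : s + 1 / R = (R * s + 1) / R := by field_simp
      rw [e3]
      field_simp
      ring_nf
      rw [e2]; ring
    have e2 : 0 ≤ (b / 2 * (R * s + 1) - √R * B * ‖w‖) ^ 2 / (b / 2 * (R * s + 1)) := by
      positivity
    have e4 : ‖S.eulerMap x s‖ * (B * ‖w‖) ≤ √R * (B * ‖w‖) := by gcongr
    linarith
  have hsquare : (B * ‖w‖) ^ 2 ≤ B ^ 2 * (S.maxStep + 1) * ‖w‖ ^ 2 / (s + 1 / R) := by
    rw [le_div_iff₀ hsR]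
    have : s + 1 / R ≤ S.maxStep + 1 := by
      have : 1 / R ≤ 1 := (div_le_one hR).2 hR1
      linarith
    calc (B * ‖w‖) ^ 2 * (s + 1 / R) ≤ (B * ‖w‖) ^ 2 * (S.maxStep + 1) := by gcongr
      _ = _ := by ring
  have hsum : ‖S.eulerMap x s + S.diffusion x w‖ ^ 2 ≤
      ‖S.eulerMap x s‖ ^ 2 + 2 * (‖S.eulerMap x s‖ * (B * ‖w‖)) + (B * ‖w‖) ^ 2 := by
    have e1 : ‖S.eulerMap x s + S.diffusion x w‖ ≤ ‖S.eulerMap x s‖ + B * ‖w‖ :=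
      (norm_add_le _ _).trans (by gcongr)
    refine (pow_le_pow_left₀ (norm_nonneg _) e1 2).trans_eq (by ring)
  have hA : S.noiseConst β B * ‖w‖ ^ 2 / (s + 1 / R) = 2 * B ^ 2 / b * ‖w‖ ^ 2 / (s + 1 / R) +
      B ^ 2 * (S.maxStep + 1) * ‖w‖ ^ 2 / (s + 1 / R) := by
    rw [noiseConst]; ring
  have hg : 2 * α + S.tol + b * S.shift α ≤ S.growth α β B := by
    rw [growth, ← hbdef]
    have : 0 ≤ 2 * (m : ℝ) ^ 2 * B ^ 2 := by positivity
    linarith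
  have hgs := mul_le_mul_of_nonneg_right hg hs
  have hxR : ‖x‖ ^ 2 = R - S.shift α := by rw [hRdef, sizeSq]; ring
  have e5 : b * s * ‖x‖ ^ 2 = b * s * R - b * s * S.shift α := by rw [hxR]; ring
  rw [hA]
  linarith

end Admissible

end AdaptiveScheme


/-- Monotonicity of the extended exponential and of its inverse reduces the supremum to pointwise
bounds, without assuming beforehand that the path is bounded. -/
theorem exp_mul_iSup_norm_sq_le {m : ℕ} {lam T : ℝ} (hlam : 0 < lam) {y : ℝ → Euc m} {V : ENNReal}
    (h : ∀ t ∈ Set.Icc (0 : ℝ) T, ENNReal.ofReal (Real.exp (lam * ‖y t‖ ^ 2)) ≤ V) :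
    EReal.exp ((lam : EReal) * ⨆ t ∈ Set.Icc (0 : ℝ) T, ((‖y t‖ ^ 2 : ℝ) : EReal)) ≤ V := by
  rw [← ENNReal.exp_log V, EReal.exp_le_exp_iff, mul_comm,
    ← EReal.le_div_iff_mul_le (by exact_mod_cast hlam) (EReal.coe_ne_top _)]
  refine iSup₂_le fun t ht => ?_
  rw [EReal.le_div_iff_mul_le (by exact_mod_cast hlam) (EReal.coe_ne_top _), mul_comm,
    ← EReal.exp_le_exp_iff, ENNReal.exp_log, ← EReal.coe_mul, EReal.exp_coe]
  exact h t ht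

/-! ### The chain: measurability, supermartingale weights and divergence of the grid times. -/

namespace AdaptiveScheme

variable {m : ℕ} {S : AdaptiveScheme m} {α β B : ℝ}

/-- The step size chosen in the state `(x, l)`. -/
def nextStep (S : AdaptiveScheme m) (p : Euc m × ℕ) : ℝ := S.stepSize (S.stepExponent p.1 p.2)

/-- One step of the chain with noise `z`. -/
def nextState (S : AdaptiveScheme m) (p : Euc m × ℕ) (z : Euc m) : Euc m × ℕ :=
  (S.eulerMap p.1 (S.nextStep p) + √(S.nextStep p) • S.diffusion p.1 z, S.stepExponent p.1 p.2)

theorem chain_succ (K : ℕ) (X : Euc m) (e : ℕ → Euc m) (n : ℕ) :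
    S.chain K X e (n + 1) = S.nextState (S.chain K X e n) (e n) := rfl

theorem step_eq (K : ℕ) (X : Euc m) (e : ℕ → Euc m) (n : ℕ) :
    S.step K X e n = S.nextStep (S.chain K X e n) := rfl

theorem time_zero (K : ℕ) (X : Euc m) (e : ℕ → Euc m) : S.time K X e 0 = 0 := by simp [time]

theorem time_succ (K : ℕ) (X : Euc m) (e : ℕ → Euc m) (n : ℕ) :
    S.time K X e (n + 1) = S.time K X e n + S.nextStep (S.chain K X e n) := by
  rw [time, Finset.sum_range_succ]; rfl

/-- The discounted exponential weight of the state at step `n`. -/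
def weight (S : AdaptiveScheme m) (α β B lam : ℝ) (K : ℕ) (X : Euc m) (e : ℕ → Euc m) (n : ℕ) : ℝ :=
  Real.exp (lam * (‖S.pos K X e n‖ ^ 2 - S.growth α β B * S.time K X e n))

namespace Admissible

theorem nextStep_pos (h : S.Admissible α β B) (p : Euc m × ℕ) : 0 < S.nextStep p :=
  h.stepSize_pos _

theorem nextStep_le (h : S.Admissible α β B) (p : Euc m × ℕ) : S.nextStep p ≤ S.maxStep :=
  h.stepSize_le _

theorem nextStep_tol (h : S.Admissible α β B) (p : Euc m × ℕ) :
    ‖S.drift (S.eulerMap p.1 (S.nextStep p)) - S.drift p.1‖ ≤ S.tol :=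
  (h.stepExponent_spec p.1 p.2).1

theorem time_strictMono (h : S.Admissible α β B) (K : ℕ) (X : Euc m) (e : ℕ → Euc m) :
    StrictMono (S.time K X e) :=
  strictMono_nat_of_lt_succ fun n => by
    rw [time_succ]; exact lt_add_of_pos_right _ (h.nextStep_pos _)

theorem time_nonneg (h : S.Admissible α β B) (K : ℕ) (X : Euc m) (e : ℕ → Euc m) (n : ℕ) :
    0 ≤ S.time K X e n := by
  rw [← S.time_zero K X e]
  exact (h.time_strictMono K X e).monotone n.zero_le

section Measurability

theorem measurable_stepExponent (h : S.Admissible α β B) :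
    Measurable fun p : Euc m × ℕ => S.stepExponent p.1 p.2 := by
  have hset : ∀ j : ℕ, MeasurableSet {p : Euc m × ℕ |
      ‖S.drift (S.eulerMap p.1 (S.stepSize j)) - S.drift p.1‖ ≤ S.tol ∧ p.2 ≤ j + 1} := by
    intro j
    have hc : Continuous fun x : Euc m => S.drift (S.eulerMap x (S.stepSize j)) - S.drift x := by
      have := h.continuous_drift
      unfold eulerMap; fun_prop
    have h1 : Measurable fun p : Euc m × ℕ =>
        ‖S.drift (S.eulerMap p.1 (S.stepSize j)) - S.drift p.1‖ :=
      (hc.norm.measurable).comp measurable_fst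
    exact (measurableSet_le h1 measurable_const).inter
      (measurableSet_le measurable_snd measurable_const)
  refine measurable_of_Iic fun k => ?_
  have e : (fun p : Euc m × ℕ => S.stepExponent p.1 p.2) ⁻¹' Set.Iic k =
      ⋃ j ∈ Set.Iic k, {p : Euc m × ℕ |
        ‖S.drift (S.eulerMap p.1 (S.stepSize j)) - S.drift p.1‖ ≤ S.tol ∧ p.2 ≤ j + 1} := by
    ext p
    simp only [Set.mem_preimage, Set.mem_Iic, Set.mem_iUnion, Set.mem_ofPred_eq, exists_prop]
    constructor
    · exact fun hp => ⟨_, hp, h.stepExponent_spec p.1 p.2⟩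
    · rintro ⟨j, hj, hp⟩
      exact le_trans (Nat.sInf_le hp) hj
  rw [e]
  exact MeasurableSet.biUnion (Set.to_countable _) fun j _ => hset j

theorem measurable_nextStep (h : S.Admissible α β B) : Measurable S.nextStep :=
  (measurable_of_countable S.stepSize).comp h.measurable_stepExponent

theorem measurable_nextState (h : S.Admissible α β B) :
    Measurable fun p : (Euc m × ℕ) × Euc m => S.nextState p.1 p.2 := by
  have h1 : Measurable fun p : (Euc m × ℕ) × Euc m => S.nextStep p.1 :=
    h.measurable_nextStep.comp measurable_fst
  have h2 : Measurable fun p : (Euc m × ℕ) × Euc m => S.stepExponent p.1.1 p.1.2 :=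
    h.measurable_stepExponent.comp measurable_fst
  have h3 : Measurable fun p : (Euc m × ℕ) × Euc m => S.diffusion p.1.1 p.2 := by
    have hc : Continuous fun p : Euc m × Euc m => S.diffusion p.1 p.2 := by
      have := h.continuous_diffusion
      fun_prop
    exact hc.measurable.comp ((measurable_fst.comp measurable_fst).prodMk measurable_snd)
  have h4 : Measurable fun p : (Euc m × ℕ) × Euc m => S.drift p.1.1 :=
    h.continuous_drift.measurable.comp (measurable_fst.comp measurable_fst)
  refine Measurable.prodMk (Measurable.add (Measurable.add (measurable_fst.comp measurable_fst)
    (h1.smul h4)) (h1.sqrt.smul h3)) h2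

end Measurability

/-- If the weights stay bounded along a path, then the grid times tend to infinity. -/
theorem tendsto_time_of_weight_le (h : S.Admissible α β B) {lam : ℝ} (hlam : 0 < lam) {K : ℕ}
    {X : Euc m} {e : ℕ → Euc m} {C : ℝ} (hC : ∀ n, S.weight α β B lam K X e n ≤ C) :
    Filter.Tendsto (S.time K X e) Filter.atTop Filter.atTop := by
  refine Filter.tendsto_atTop_atTop_of_monotone (h.time_strictMono K X e).monotone ?_
  by_contra! hcon
  obtain ⟨b, hb⟩ := hcon
  have hCpos : 0 < C := (Real.exp_pos _).trans_le (hC 0)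
  set r2 := Real.log C / lam + S.growth α β B * b with hr2
  have hx : ∀ n, ‖S.pos K X e n‖ ≤ √r2 := by
    intro n
    apply Real.le_sqrt_of_sq_le
    have h1 := (Real.le_log_iff_exp_le hCpos).2 (hC n)
    have h2 : ‖S.pos K X e n‖ ^ 2 - S.growth α β B * S.time K X e n ≤ Real.log C / lam := by
      rw [le_div_iff₀ hlam]; linarith
    have h3 := mul_le_mul_of_nonneg_left (hb n).le h.growth_pos.le
    linarith
  obtain ⟨k₀, hk₀⟩ := h.exists_forall_tol (√r2)
  -- On a ball every exponent from k₀ on meets the tolerance, and the constraint k ≥ l - 1 never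
  -- forces the exponent above the previous value l. So exponents cannot exceed max k₀ K, and the
  -- steps are bounded below.
  have hk : ∀ n, (S.chain K X e n).2 ≤ max k₀ K := by
    intro n
    induction n with
    | zero => exact le_max_right _ _
    | succ n ih =>
      rw [chain_succ]
      exact (stepExponent_le _ hk₀ (hx n) _).trans (max_le (le_max_left _ _) ih)
  set d := S.stepSize (max k₀ K) with hd
  have hdpos : 0 < d := h.stepSize_pos _
  have ht : ∀ n : ℕ, n * d ≤ S.time K X e n := by
    intro n
    induction n with
    | zero => simp [time_zero]
    | succ n ih =>
      rw [time_succ]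
      have h1 : d ≤ S.nextStep (S.chain K X e n) := h.stepSize_antitone (hk (n + 1))
      push_cast
      linarith
  obtain ⟨n, hn⟩ := exists_nat_gt (b / d)
  rw [div_lt_iff₀ hdpos] at hn
  linarith [ht n, hb n]

theorem exp_norm_pos_sq_le (h : S.Admissible α β B) {lam : ℝ} (hlam : 0 < lam) {K : ℕ}
    {X : Euc m} {e : ℕ → Euc m} {n : ℕ} {T : ℝ} (hT : S.time K X e n ≤ T) :
    Real.exp (lam * ‖S.pos K X e n‖ ^ 2) ≤
      Real.exp (lam * S.growth α β B * T) * S.weight α β B lam K X e n := by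
  rw [weight, ← Real.exp_add]
  apply Real.exp_le_exp.2
  have := mul_le_mul_of_nonneg_left hT (mul_pos hlam h.growth_pos).le
  linarith

theorem index_spec (h : S.Admissible α β B) {K : ℕ} {X : Euc m} {e : ℕ → Euc m}
    (ht : Filter.Tendsto (S.time K X e) Filter.atTop Filter.atTop) {t : ℝ} (ht0 : 0 ≤ t) :
    S.time K X e (S.index K X e t) ≤ t ∧ t < S.time K X e (S.index K X e t + 1) := by
  obtain ⟨N, hN⟩ := (Filter.tendsto_atTop.1 ht (t + 1)).exists
  have hbdd : BddAbove {n : ℕ | S.time K X e n ≤ t} := ⟨N, fun n hn => by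
    by_contra hcon
    have := (h.time_strictMono K X e).monotone (not_le.1 hcon).le
    have hn' : S.time K X e n ≤ t := hn
    linarith⟩
  have hne : {n : ℕ | S.time K X e n ≤ t}.Nonempty := ⟨0, by simpa [time_zero] using ht0⟩
  refine ⟨Nat.sSup_mem hne hbdd, ?_⟩
  by_contra hcon
  have : S.index K X e t + 1 ≤ S.index K X e t := le_csSup hbdd (not_lt.1 hcon)
  omega

section Noise

variable {Ω : Type*} {mΩ : MeasurableSpace Ω} {μ : Measure Ω} {η : ℕ → Ω → Euc m}

/-- The `σ`-algebra generated by the first `n` noise vectors. -/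
@[reducible] def noisePast (η : ℕ → Ω → Euc m) (n : ℕ) : MeasurableSpace Ω :=
  ⨆ i ∈ Set.Iio n, MeasurableSpace.comap (η i) inferInstance

theorem noisePast_mono : Monotone (noisePast η) := fun _ _ hij =>
  biSup_mono fun _ hk => lt_of_lt_of_le hk hij

theorem noisePast_le (hη : ∀ n, Measurable (η n)) (n : ℕ) : noisePast η n ≤ mΩ :=
  iSup₂_le fun i _ => (hη i).comap_le

theorem measurable_noisePast (n : ℕ) : Measurable[noisePast η (n + 1)] (η n) := by
  rw [measurable_iff_comap_le]
  exact le_biSup (fun i => MeasurableSpace.comap (η i) inferInstance) (Set.mem_Iio.2 n.lt_succ_self)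

theorem indep_noisePast (hη : ∀ n, Measurable (η n)) (hind : iIndepFun η μ) (n : ℕ) :
    Indep (noisePast η n) (MeasurableSpace.comap (η n) inferInstance) μ := by
  have := indep_iSup_of_disjoint (fun i => (hη i).comap_le) hind.iIndep (S := Set.Iio n) (T := {n})
    (by simp)
  simpa [noisePast] using this

theorem measurable_chain (h : S.Admissible α β B) (K : ℕ) (X : Euc m) (n : ℕ) :
    Measurable[noisePast η n] fun ω => S.chain K X (fun i => η i ω) n := by
  induction n with
  | zero => exact @measurable_const _ _ _ (noisePast η 0) _
  | succ n ih =>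
    exact h.measurable_nextState.comp (Measurable.prodMk
      (ih.mono (noisePast_mono n.le_succ) le_rfl) (measurable_noisePast n))

/-- The step length is chosen before the noise of that step is drawn, so t_{n+1} is predictable. -/
theorem measurable_time_succ (h : S.Admissible α β B) (K : ℕ) (X : Euc m) (n : ℕ) :
    Measurable[noisePast η n] fun ω => S.time K X (fun i => η i ω) (n + 1) := by
  induction n with
  | zero =>
    simp_rw [time_succ, time_zero]
    exact (h.measurable_nextStep.comp (h.measurable_chain K X 0)).const_add 0
  | succ n ih =>
    simp_rw [time_succ _ _ _ (n + 1)]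
    exact (ih.mono (noisePast_mono n.le_succ) le_rfl).add
      (h.measurable_nextStep.comp (h.measurable_chain K X (n + 1)))

theorem measurable_time (h : S.Admissible α β B) (K : ℕ) (X : Euc m) (n : ℕ) :
    Measurable[noisePast η n] fun ω => S.time K X (fun i => η i ω) n := by
  cases n with
  | zero => simp_rw [time_zero]; exact @measurable_const _ _ _ (noisePast η 0) _
  | succ n => exact (h.measurable_time_succ K X n).mono (noisePast_mono n.le_succ) le_rfl

theorem measurable_weight (h : S.Admissible α β B) (lam : ℝ) (K : ℕ) (X : Euc m) (n : ℕ) :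
    Measurable[noisePast η n] fun ω => S.weight α β B lam K X (fun i => η i ω) n := by
  have h1 : Measurable fun p : (Euc m × ℕ) × ℝ =>
      Real.exp (lam * (‖p.1.1‖ ^ 2 - S.growth α β B * p.2)) := by fun_prop
  have h2 : Measurable[noisePast η n] fun ω =>
      (S.chain K X (fun i => η i ω) n, S.time K X (fun i => η i ω) n) :=
    (h.measurable_chain K X n).prodMk (h.measurable_time K X n)
  have h3 := h1.comp h2
  simpa only [weight, pos, Function.comp_def] using h3

theorem lintegral_mul_weight_succ_le (h : S.Admissible α β B) [IsProbabilityMeasure μ]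
    (hη : ∀ n, Measurable (η n)) (hlaw : ∀ n, μ.map (η n) = stdGaussian (Euc m))
    (hind : iIndepFun η μ) {lam : ℝ} (hlam : 0 < lam)
    (h1 : 8 * lam * B ^ 2 ≤ 2 * β - S.tol) (h2 : 8 * m * lam * B ^ 2 * S.maxStep ≤ 1)
    (K : ℕ) (X : Euc m) (n : ℕ) {g : Ω → ENNReal} (hg : Measurable[noisePast η n] g) :
    ∫⁻ ω, g ω * ENNReal.ofReal (S.weight α β B lam K X (fun i => η i ω) (n + 1)) ∂μ ≤
      ∫⁻ ω, g ω * ENNReal.ofReal (S.weight α β B lam K X (fun i => η i ω) n *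
        Real.exp (-(lam * S.rate β * (S.sizeSq α (S.pos K X (fun i => η i ω) n) *
          S.step K X (fun i => η i ω) n)))) ∂μ := by
  -- Since t_{n+1} is predictable, the discount factor joins the test function and only the norm of
  -- the new state is averaged.
  let g' : Ω → ENNReal := fun ω => g ω * ENNReal.ofReal
    (Real.exp (-(lam * S.growth α β B * S.time K X (fun i => η i ω) (n + 1))))
  have hg' : Measurable[noisePast η n] g' :=
    hg.mul (((h.measurable_time_succ K X n).const_mul _).neg.exp.ennreal_ofReal)
  have key := lintegral_mul_le_of_indep (noisePast_le hη n) (hη n) (indep_noisePast hη hind n)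
    (h.measurable_chain K X n)
    (F := fun p z => ENNReal.ofReal (Real.exp (lam * ‖(S.nextState p z).1‖ ^ 2)))
    ((((measurable_fst.comp h.measurable_nextState).norm.pow_const 2).const_mul
      lam).exp.ennreal_ofReal)
    (G := fun p => ENNReal.ofReal (Real.exp (lam * (‖p.1‖ ^ 2 -
      S.rate β * (S.sizeSq α p.1 * S.nextStep p) + S.growth α β B * S.nextStep p))))
    (fun p => by
      have hm : Measurable fun z : Euc m =>
          ENNReal.ofReal (Real.exp (lam * ‖(S.nextState p z).1‖ ^ 2)) := by
        have := measurable_fst.comp (h.measurable_nextState.comp (measurable_prodMk_left (x := p)))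
        exact ((this.norm.pow_const 2).const_mul lam).exp.ennreal_ofReal
      rw [← lintegral_map hm (hη n), hlaw n]
      exact h.lintegral_exp_step_le hlam h1 h2 (h.nextStep_pos p).le (h.nextStep_le p)
        (h.nextStep_tol p)) hg'
  refine le_trans (le_of_eq ?_) (key.trans (le_of_eq ?_))
  · refine lintegral_congr fun ω => ?_
    simp only [g']
    rw [mul_assoc, ← ENNReal.ofReal_mul (Real.exp_pos _).le, ← Real.exp_add, weight]
    congr 3
    rw [pos, chain_succ]; ring
  · refine lintegral_congr fun ω => ?_
    simp only [g']
    rw [mul_assoc, ← ENNReal.ofReal_mul (Real.exp_pos _).le, weight, ← Real.exp_add,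
      ← Real.exp_add]
    congr 3
    rw [time_succ, pos, step_eq]; ring

/-- The square of the weight with parameter `lam` is the weight with parameter 2 `lam`. This is why
the smallness conditions are imposed on 2 `lam`. -/
theorem lintegral_iSup_weight_le (h : S.Admissible α β B) [IsProbabilityMeasure μ]
    (hη : ∀ n, Measurable (η n)) (hlaw : ∀ n, μ.map (η n) = stdGaussian (Euc m))
    (hind : iIndepFun η μ) {lam : ℝ} (hlam : 0 < lam)
    (h1 : 8 * (2 * lam) * B ^ 2 ≤ 2 * β - S.tol)
    (h2 : 8 * m * (2 * lam) * B ^ 2 * S.maxStep ≤ 1) (K : ℕ) (X : Euc m) :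
    ∫⁻ ω, ⨆ n, ENNReal.ofReal (S.weight α β B lam K X (fun i => η i ω) n) ∂μ ≤
      ENNReal.ofReal (2 * Real.exp (lam * ‖X‖ ^ 2)) := by
  refine lintegral_iSup_le_two_mul (fun n => noisePast_le hη n) noisePast_mono
    (fun n => h.measurable_weight lam K X n) (fun n ω => Real.exp_pos _) (fun ω => by
      simp [weight, time_zero, pos, chain]) fun n g hg => ?_
  have e : ∀ k ω, S.weight α β B lam K X (fun i => η i ω) k ^ 2 =
      S.weight α β B (2 * lam) K X (fun i => η i ω) k := by
    intro k ω
    rw [weight, weight, ← Real.exp_nat_mul]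
    congr 1; push_cast; ring
  simp_rw [e]
  refine (h.lintegral_mul_weight_succ_le hη hlaw hind (by positivity) h1 h2 K X n hg).trans ?_
  refine lintegral_mono fun ω => ?_
  gcongr
  refine mul_le_of_le_one_right (Real.exp_pos _).le ?_
  rw [Real.exp_le_one_iff]
  have := h.rate_pos
  have := h.sizeSq_pos (S.pos K X (fun i => η i ω) n)
  have := h.nextStep_pos (S.chain K X (fun i => η i ω) n)
  rw [step_eq]
  have : 0 ≤ 2 * lam * S.rate β * (S.sizeSq α (S.pos K X (fun i => η i ω) n) *
    S.nextStep (S.chain K X (fun i => η i ω) n)) := by positivity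
  linarith

/-- The one-step estimate says that the expected weight drops by at least the n-th term, so the sum
telescopes. It bounds the budget from which the excursions of all steps are paid. -/
theorem tsum_lintegral_weight_mul_le (h : S.Admissible α β B) [IsProbabilityMeasure μ]
    (hη : ∀ n, Measurable (η n)) (hlaw : ∀ n, μ.map (η n) = stdGaussian (Euc m))
    (hind : iIndepFun η μ) {lam : ℝ} (hlam : 0 < lam)
    (h1 : 8 * lam * B ^ 2 ≤ 2 * β - S.tol)
    (h2 : 8 * m * lam * B ^ 2 * S.maxStep ≤ 1) (K : ℕ) (X : Euc m) :
    ∑' n, ∫⁻ ω, ENNReal.ofReal (S.weight α β B lam K X (fun i => η i ω) n) *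
        ENNReal.ofReal (1 - Real.exp (-(lam * S.rate β *
          (S.sizeSq α (S.pos K X (fun i => η i ω) n) * S.step K X (fun i => η i ω) n)))) ∂μ ≤
      ENNReal.ofReal (Real.exp (lam * ‖X‖ ^ 2)) := by
  have hwm : ∀ n, Measurable fun ω => S.weight α β B lam K X (fun i => η i ω) n := fun n =>
    (h.measurable_weight lam K X n).mono (noisePast_le hη n) le_rfl
  let a : ℕ → ENNReal := fun n =>
    ∫⁻ ω, ENNReal.ofReal (S.weight α β B lam K X (fun i => η i ω) n) ∂μ
  let d : ℕ → ENNReal := fun n =>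
    ∫⁻ ω, ENNReal.ofReal (S.weight α β B lam K X (fun i => η i ω) n) *
        ENNReal.ofReal (1 - Real.exp (-(lam * S.rate β *
          (S.sizeSq α (S.pos K X (fun i => η i ω) n) * S.step K X (fun i => η i ω) n)))) ∂μ
  have hstep : ∀ n, a (n + 1) + d n ≤ a n := by
    intro n
    have h3 := h.lintegral_mul_weight_succ_le hη hlaw hind hlam h1 h2 K X n
      (g := fun _ => 1) (@measurable_const _ _ _ (noisePast η n) _)
    simp only [one_mul] at h3
    have hRm : Measurable fun ω => S.sizeSq α (S.pos K X (fun i => η i ω) n) *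
        S.step K X (fun i => η i ω) n := by
      have hc := (h.measurable_chain (η := η) K X n).mono (noisePast_le hη n) le_rfl
      have h4 := (measurable_fst.comp hc).norm.pow_const 2
      exact (h4.add_const _).mul (h.measurable_nextStep.comp hc)
    refine (add_le_add_left h3 _).trans (le_of_eq ?_)
    rw [← lintegral_add_left]
    · refine lintegral_congr fun ω => ?_
      have hw : 0 ≤ S.weight α β B lam K X (fun i => η i ω) n := (Real.exp_pos _).le
      have hle : Real.exp (-(lam * S.rate β * (S.sizeSq α (S.pos K X (fun i => η i ω) n) *
          S.step K X (fun i => η i ω) n))) ≤ 1 := by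
        rw [Real.exp_le_one_iff]
        have := h.rate_pos
        have := h.sizeSq_pos (S.pos K X (fun i => η i ω) n)
        have := h.nextStep_pos (S.chain K X (fun i => η i ω) n)
        rw [step_eq]
        have : 0 ≤ lam * S.rate β * (S.sizeSq α (S.pos K X (fun i => η i ω) n) *
          S.nextStep (S.chain K X (fun i => η i ω) n)) := by positivity
        linarith
      rw [← ENNReal.ofReal_mul hw, ← ENNReal.ofReal_add (mul_nonneg hw (Real.exp_pos _).le)
        (mul_nonneg hw (by linarith))]
      congr 1; ring
    · exact ((hwm n).mul ((hRm.const_mul _).neg.exp)).ennreal_ofReal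
  have hsum : ∀ N, a N + ∑ n ∈ Finset.range N, d n ≤ a 0 := by
    intro N
    induction N with
    | zero => simp
    | succ N ih =>
      refine le_trans ?_ ih
      rw [Finset.sum_range_succ, add_comm (∑ n ∈ Finset.range N, d n), ← add_assoc]
      gcongr
      exact hstep N
  have ha0 : a 0 = ENNReal.ofReal (Real.exp (lam * ‖X‖ ^ 2)) := by
    simp [a, weight, time_zero, pos, chain]
  rw [← ha0, ENNReal.tsum_eq_iSup_nat]
  exact iSup_le fun N => le_trans le_add_self (hsum N)

/-- A supremum with finite expectation is finite almost surely, and a path with bounded weights has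
divergent grid times. -/
theorem ae_tendsto_time (h : S.Admissible α β B) [IsProbabilityMeasure μ]
    (hη : ∀ n, Measurable (η n)) (hlaw : ∀ n, μ.map (η n) = stdGaussian (Euc m))
    (hind : iIndepFun η μ) {lam : ℝ} (hlam : 0 < lam)
    (h1 : 8 * (2 * lam) * B ^ 2 ≤ 2 * β - S.tol)
    (h2 : 8 * m * (2 * lam) * B ^ 2 * S.maxStep ≤ 1) (K : ℕ) (X : Euc m) :
    ∀ᵐ ω ∂μ, Filter.Tendsto (S.time K X (fun n => η n ω)) Filter.atTop Filter.atTop := by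
  have hfin := (h.lintegral_iSup_weight_le hη hlaw hind hlam h1 h2 K X).trans_lt
    ENNReal.ofReal_lt_top
  have hm : Measurable fun ω => ⨆ n, ENNReal.ofReal (S.weight α β B lam K X (fun i => η i ω) n) :=
    Measurable.iSup fun n =>
      ((h.measurable_weight lam K X n).mono (noisePast_le hη n) le_rfl).ennreal_ofReal
  filter_upwards [ae_lt_top hm hfin.ne] with ω hω
  refine h.tendsto_time_of_weight_le hlam
    (C := (⨆ n, ENNReal.ofReal (S.weight α β B lam K X (fun i => η i ω) n)).toReal) fun n => ?_
  rw [← ENNReal.ofReal_le_iff_le_toReal hω.ne]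
  exact le_iSup (fun n => ENNReal.ofReal (S.weight α β B lam K X (fun i => η i ω) n)) n

theorem expSupMoment_pcInterp_le (h : S.Admissible α β B) [IsProbabilityMeasure μ]
    (hη : ∀ n, Measurable (η n)) (hlaw : ∀ n, μ.map (η n) = stdGaussian (Euc m))
    (hind : iIndepFun η μ) {lam : ℝ} (hlam : 0 < lam)
    (h1 : 8 * (2 * lam) * B ^ 2 ≤ 2 * β - S.tol)
    (h2 : 8 * m * (2 * lam) * B ^ 2 * S.maxStep ≤ 1) (K : ℕ) (X : Euc m) (T : ℝ) :
    expSupMoment μ lam T (fun t ω => S.pcInterp K X (fun n => η n ω) t) ≤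
      ENNReal.ofReal (Real.exp (lam * S.growth α β B * T)) *
        ENNReal.ofReal (2 * Real.exp (lam * ‖X‖ ^ 2)) := by
  refine le_trans ?_ (mul_le_mul_right (h.lintegral_iSup_weight_le hη hlaw hind hlam h1 h2 K X) _)
  rw [← lintegral_const_mul _ (Measurable.iSup fun n =>
      ((h.measurable_weight lam K X n).mono (noisePast_le hη n) le_rfl).ennreal_ofReal)]
  refine lintegral_mono_ae ?_
  filter_upwards [h.ae_tendsto_time hη hlaw hind hlam h1 h2 K X] with ω hω
  refine exp_mul_iSup_norm_sq_le hlam fun t ht => ?_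
  refine (ENNReal.ofReal_le_ofReal (h.exp_norm_pos_sq_le hlam
    ((h.index_spec hω ht.1).1.trans ht.2))).trans ?_
  rw [ENNReal.ofReal_mul (Real.exp_pos _).le]
  gcongr
  exact le_iSup (fun n => ENNReal.ofReal (S.weight α β B lam K X (fun i => η i ω) n)) _

end Noise

end Admissible

end AdaptiveScheme


/-! ### The continuous interpolant within a time step. -/

section Interpolant

/-- The interpolant may jump at the right end of a grid interval, so constancy is available only on
the half-open interval. -/
theorem intervalIntegral_eq_of_eqOn_Ico {E : Type*} [NormedAddCommGroup E] [NormedSpace ℝ E]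
    [CompleteSpace E] {f : ℝ → E} {c : E} {a b : ℝ} (hab : a ≤ b) (hf : ∀ s ∈ Set.Ico a b, f s = c) :
    IntervalIntegrable f volume a b ∧ ∫ s in a..b, f s = (b - a) • c := by
  have h : Set.EqOn f (fun _ => c) (Set.Ioo a b) := fun s hs => hf s ⟨hs.1.le, hs.2⟩
  constructor
  · exact (intervalIntegrable_const (c := c)).congr_uIoo
      (by rw [Set.uIoo_of_le hab]; exact h.symm)
  · rw [intervalIntegral.integral_congr_Ioo_of_le hab h, intervalIntegral.integral_const]

namespace AdaptiveScheme

variable {m : ℕ} {S : AdaptiveScheme m} {α β B : ℝ}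

theorem pos_succ (K : ℕ) (X : Euc m) (e : ℕ → Euc m) (n : ℕ) :
    S.pos K X e (n + 1) = S.pos K X e n + S.step K X e n • S.drift (S.pos K X e n) +
      S.diffusion (S.pos K X e n) (√(S.step K X e n) • e n) := by
  rw [map_smul]; rfl

namespace Admissible

variable {K : ℕ} {X : Euc m} {e : ℕ → Euc m}

theorem index_eq (h : S.Admissible α β B)
    (ht : Filter.Tendsto (S.time K X e) Filter.atTop Filter.atTop) {n : ℕ} {t : ℝ}
    (h1 : S.time K X e n ≤ t) (h2 : t < S.time K X e (n + 1)) : S.index K X e t = n := by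
  have ht0 : 0 ≤ t := (h.time_nonneg K X e n).trans h1
  obtain ⟨h3, h4⟩ := h.index_spec ht ht0
  have h5 := (h.time_strictMono K X e).lt_iff_lt.1 (h3.trans_lt h2)
  have h6 := (h.time_strictMono K X e).lt_iff_lt.1 (h1.trans_lt h4)
  omega

theorem integral_drift_pcInterp (h : S.Admissible α β B)
    (ht : Filter.Tendsto (S.time K X e) Filter.atTop Filter.atTop) {n : ℕ} {t : ℝ}
    (h1 : S.time K X e n ≤ t) (h2 : t ≤ S.time K X e (n + 1)) :
    IntervalIntegrable (fun s => S.drift (S.pcInterp K X e s)) volume (S.time K X e n) t ∧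
    ∫ s in (S.time K X e n)..t, S.drift (S.pcInterp K X e s) =
      (t - S.time K X e n) • S.drift (S.pos K X e n) := by
  refine intervalIntegral_eq_of_eqOn_Ico h1 fun s hs => ?_
  rw [pcInterp, h.index_eq ht hs.1 (hs.2.trans_le h2)]

theorem integral_drift_pcInterp_time (h : S.Admissible α β B)
    (ht : Filter.Tendsto (S.time K X e) Filter.atTop Filter.atTop) (n : ℕ) :
    IntervalIntegrable (fun s => S.drift (S.pcInterp K X e s)) volume 0 (S.time K X e n) ∧
    ∫ s in (0 : ℝ)..(S.time K X e n), S.drift (S.pcInterp K X e s) =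
      ∑ i ∈ Finset.range n, S.step K X e i • S.drift (S.pos K X e i) := by
  induction n with
  | zero => simp [time_zero]
  | succ n ih =>
    obtain ⟨i1, e1⟩ := h.integral_drift_pcInterp ht
      ((h.time_strictMono K X e).monotone n.le_succ) le_rfl
    refine ⟨ih.1.trans i1, ?_⟩
    rw [← intervalIntegral.integral_add_adjacent_intervals ih.1 i1, ih.2, e1,
      Finset.sum_range_succ, time_succ, step_eq, add_sub_cancel_left]

theorem pos_eq_sum (K : ℕ) (X : Euc m) {e : ℕ → Euc m} {W : ℝ≥0 → Euc m}
    (hW : S.DrivenBy K X e W) (n : ℕ) :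
    S.pos K X e n = X + ∑ i ∈ Finset.range n, S.step K X e i • S.drift (S.pos K X e i) +
      ∑ i ∈ Finset.range n, S.diffusion (S.pos K X e i)
        (W (S.time K X e (i + 1)).toNNReal - W (S.time K X e i).toNNReal) := by
  induction n with
  | zero => simp [pos, chain]
  | succ n ih =>
    rw [pos_succ, Finset.sum_range_succ, Finset.sum_range_succ, hW n]
    refine (congrArg (fun z => z + S.step K X e n • S.drift (S.pos K X e n) +
      S.diffusion (S.pos K X e n) (W (S.time K X e (n + 1)).toNNReal -
        W (S.time K X e n).toNNReal)) ih).trans ?_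
    abel

/-- Within a time step the continuous interpolant is an Euler step with frozen coefficients. -/
theorem contInterp_eq (h : S.Admissible α β B)
    (ht : Filter.Tendsto (S.time K X e) Filter.atTop Filter.atTop) {W : ℝ≥0 → Euc m}
    (hW : S.DrivenBy K X e W) {n : ℕ} {t : ℝ} (h1 : S.time K X e n ≤ t)
    (h2 : t < S.time K X e (n + 1)) :
    S.contInterp K X e W t = S.eulerMap (S.pos K X e n) (t - S.time K X e n) +
      S.diffusion (S.pos K X e n) (W t.toNNReal - W (S.time K X e n).toNNReal) := by
  obtain ⟨i1, e1⟩ := h.integral_drift_pcInterp ht h1 h2.le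
  obtain ⟨i2, e2⟩ := h.integral_drift_pcInterp_time ht n
  have hp := pos_eq_sum K X hW n
  rw [contInterp, ← intervalIntegral.integral_add_adjacent_intervals i2 i1, e1, e2, itoIntegral]
  simp only [h.index_eq ht h1 h2, eulerMap]
  nth_rewrite 3 [hp]
  abel

end Admissible

end AdaptiveScheme

end Interpolant

/-! ### Brownian motion: a measurable version and independence of the past. -/

section Past

variable {Ω : Type*} {mΩ : MeasurableSpace Ω} {μ : Measure Ω} {m : ℕ}

/-- Lets past and future of each component be merged with the independence of the components into
one family over `Fin m × Bool`. -/
theorem iIndepFun_bool_of_indepFun [IsProbabilityMeasure μ] {E : Type*} [MeasurableSpace E]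
    {f : Bool → Ω → E} (hf : IndepFun (f true) (f false) μ) : iIndepFun f μ := by
  rw [iIndepFun_iff_measure_inter_preimage_eq_mul]
  intro s sets hs
  have key : ∀ t u, MeasurableSet t → MeasurableSet u →
      μ (f true ⁻¹' t ∩ f false ⁻¹' u) = μ (f true ⁻¹' t) * μ (f false ⁻¹' u) :=
    indepFun_iff_measure_inter_preimage_eq_mul.1 hf
  by_cases ht : true ∈ s <;> by_cases hfs : false ∈ s
  · have : s = {true, false} := by ext b; cases b <;> simp [ht, hfs]
    subst this
    rw [Finset.set_biInter_insert, Finset.set_biInter_singleton, Finset.prod_pair (by decide)]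
    exact key _ _ (hs _ ht) (hs _ hfs)
  · have : s = {true} := by ext b; cases b <;> simp [ht, hfs]
    subst this; simp
  · have : s = {false} := by ext b; cases b <;> simp [ht, hfs]
    subst this; simp
  · have : s = ∅ := by ext b; cases b <;> simp [ht, hfs]
    subst this; simp

theorem measurable_euc_of_apply {m : ℕ} {Ω : Type*} {_ : MeasurableSpace Ω} {f : Ω → Euc m}
    (hf : ∀ i, Measurable fun ω => f ω i) : Measurable f :=
  (WithLp.measurable_toLp 2 (Fin m → ℝ)).comp (measurable_pi_lambda _ hf)

/-- A measurable process with independent pre-Brownian components. -/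
structure IsMeasurablePreBrownianEuc (V : ℝ≥0 → Ω → Euc m) (μ : Measure Ω) : Prop where
  measurable : ∀ t, Measurable (V t)
  preBrownian : ∀ i : Fin m, IsPreBrownianReal (fun t ω => V t ω i) μ
  indep : iIndepFun (fun (i : Fin m) (ω : Ω) (t : ℝ≥0) => V t ω i) μ

/-- The given process is only almost everywhere measurable at each time. The modification gains
measurability but may lose continuity, so it will be compared with W only at countably many times.
-/
theorem IsBrownianEuc.exists_modification {W : ℝ≥0 → Ω → Euc m} (hW : IsBrownianEuc W μ) :
    ∃ V : ℝ≥0 → Ω → Euc m, IsMeasurablePreBrownianEuc V μ ∧ ∀ t, W t =ᵐ[μ] V t := by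
  have hm : ∀ t, AEMeasurable (W t) μ := fun t =>
    (WithLp.measurable_toLp 2 (Fin m → ℝ)).comp_aemeasurable
      (aemeasurable_pi_lambda (fun ω i => W t ω i) fun i => (hW.brownian i).aemeasurable t)
  have hi : ∀ i t, (fun ω => W t ω i) =ᵐ[μ] fun ω => (hm t).mk (W t) ω i := fun i t => by
    filter_upwards [(hm t).ae_eq_mk] with ω hω
    rw [hω]
  refine ⟨fun t => (hm t).mk (W t), ⟨fun t => (hm t).measurable_mk, fun i => ?_, ?_⟩,
    fun t => (hm t).ae_eq_mk⟩
  · exact (hW.brownian i).toIsPreBrownianReal.congr (hi i)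
  · exact iIndepFun.process_congr (X := fun (i : Fin m) (t : ℝ≥0) (ω : Ω) => W t ω i) hW.indep hi

namespace IsMeasurablePreBrownianEuc

/-- The `σ`-algebra of the path up to time `τ`. -/
@[reducible] def past (V : ℝ≥0 → Ω → Euc m) (τ : ℝ≥0) : MeasurableSpace Ω :=
  MeasurableSpace.comap (fun ω (t : ℝ≥0) => V (min t τ) ω) inferInstance

variable {V : ℝ≥0 → Ω → Euc m}

theorem past_le (hV : IsMeasurablePreBrownianEuc V μ) (τ : ℝ≥0) : past V τ ≤ mΩ :=
  (measurable_pi_lambda _ fun t => hV.measurable (min t τ)).comap_le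

theorem measurable_past {t τ : ℝ≥0} (h : t ≤ τ) : Measurable[past V τ] (V t) := by
  have := (measurable_pi_apply t).comp (comap_measurable fun ω (t : ℝ≥0) => V (min t τ) ω)
  simpa [Function.comp_def, min_eq_left h] using this

theorem past_mono {σ τ : ℝ≥0} (h : σ ≤ τ) : past V σ ≤ past V τ := by
  refine Measurable.comap_le ?_
  exact @measurable_pi_lambda _ _ _ (past V τ) _ _ fun t =>
    measurable_past ((min_le_right t σ).trans h)

/-- The increments after `τ` are independent of the path up to `τ`. -/
theorem indep_past [IsProbabilityMeasure μ] (hV : IsMeasurablePreBrownianEuc V μ) (τ : ℝ≥0) :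
    Indep (past V τ)
      (MeasurableSpace.comap (fun ω (t : ℝ≥0) => V (τ + t) ω - V τ ω) inferInstance) μ := by
  -- The value false selects the path stopped at τ, the value true the increments after τ. All 2m
  -- resulting processes are shown to be independent and are then grouped by the Boolean.
  let ψ : Bool → (ℝ≥0 → ℝ) → ℝ≥0 → ℝ := fun c p t => if c then p (τ + t) - p τ else p (min t τ)
  have hψ : ∀ c, Measurable (ψ c) := by
    intro c
    refine measurable_pi_lambda _ fun t => ?_
    cases c
    · simpa [ψ] using measurable_pi_apply (min t τ)
    · exact (measurable_pi_apply (τ + t)).sub (measurable_pi_apply τ)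
  have hVi : ∀ i, Measurable fun ω (t : ℝ≥0) => V t ω i := fun i =>
    measurable_pi_lambda _ fun t => by have := hV.measurable t; fun_prop
  let Z : Fin m → Bool → Ω → ℝ≥0 → ℝ := fun i c ω => ψ c fun t => V t ω i
  have hZ : ∀ i c, Measurable (Z i c) := fun i c => (hψ c).comp (hVi i)
  have hind : iIndepFun (fun (p : Fin m × Bool) ω => Z p.1 p.2 ω) μ := by
    refine iIndepFun_uncurry' hZ ?_ fun i => iIndepFun_bool_of_indepFun ?_
    · exact hV.indep.comp (fun i p c => ψ c p) fun i => measurable_pi_lambda _ hψ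
    · have h1 := ((hV.preBrownian i).indepFun_shift τ).comp measurable_id
        (ψ := fun (p : Set.Iic τ → ℝ) (t : ℝ≥0) => p ⟨min t τ, min_le_right t τ⟩)
        (measurable_pi_lambda _ fun t => measurable_pi_apply _)
      simpa [Z, ψ, Function.comp_def] using h1
  have hsup := indep_iSup_of_disjoint (fun p : Fin m × Bool => (hZ p.1 p.2).comap_le) hind.iIndep
    (S := {p | p.2 = false}) (T := {p | p.2 = true})
    (by rw [Set.disjoint_left]; intro p hp hq; simp at hp hq; simp [hp] at hq)
  refine indep_of_indep_of_le hsup ?_ ?_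
  · refine Measurable.comap_le ?_
    refine @measurable_pi_lambda _ _ _ (_) _ _ fun t => measurable_euc_of_apply fun i => ?_
    have h1 : MeasurableSpace.comap (Z i false) inferInstance ≤
        ⨆ p ∈ {p : Fin m × Bool | p.2 = false}, MeasurableSpace.comap (Z p.1 p.2) inferInstance :=
      le_biSup (fun p : Fin m × Bool => MeasurableSpace.comap (Z p.1 p.2) inferInstance)
        (show (i, false) ∈ {p : Fin m × Bool | p.2 = false} from rfl)
    have h2 := ((measurable_pi_apply t).comp (comap_measurable (Z i false))).mono h1 le_rfl
    simpa [Z, ψ, Function.comp_def] using h2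
  · refine Measurable.comap_le ?_
    refine @measurable_pi_lambda _ _ _ (_) _ _ fun t => measurable_euc_of_apply fun i => ?_
    have h1 : MeasurableSpace.comap (Z i true) inferInstance ≤
        ⨆ p ∈ {p : Fin m × Bool | p.2 = true}, MeasurableSpace.comap (Z p.1 p.2) inferInstance :=
      le_biSup (fun p : Fin m × Bool => MeasurableSpace.comap (Z p.1 p.2) inferInstance)
        (show (i, true) ∈ {p : Fin m × Bool | p.2 = true} from rfl)
    have h2 := ((measurable_pi_apply t).comp (comap_measurable (Z i true))).mono h1 le_rfl
    simpa [Z, ψ, Function.comp_def] using h2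

end IsMeasurablePreBrownianEuc

end Past


/-! ### The strong Markov property at the random grid times. -/

namespace AdaptiveScheme

variable {m : ℕ} {S : AdaptiveScheme m} {α β B : ℝ}

/-- The chain together with its current time, driven directly by a path `V`. -/
def drivenState (S : AdaptiveScheme m) (K : ℕ) (X : Euc m) (V : ℝ≥0 → Euc m) :
    ℕ → (Euc m × ℕ) × ℝ≥0
  | 0 => ((X, K), 0)
  | n + 1 =>
    let p := drivenState S K X V n
    ((S.eulerMap p.1.1 (S.nextStep p.1) +
        S.diffusion p.1.1 (V (p.2 + (S.nextStep p.1).toNNReal) - V p.2),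
      S.stepExponent p.1.1 p.1.2), p.2 + (S.nextStep p.1).toNNReal)

/-- The worst excess of an excursion of the path `y` during the step from the state `p`. -/
def excursionSup (S : AdaptiveScheme m) (α β B lam : ℝ) (p : Euc m × ℕ) (y : ℝ≥0 → Euc m) :
    ENNReal :=
  ⨆ q : ℚ≥0, ⨆ _ : ((q : ℝ≥0) : ℝ) ≤ S.nextStep p,
    ENNReal.ofReal (excursionExcess lam (S.rate β) (S.noiseConst β B) (S.sizeSq α p.1) (q : ℝ≥0)
      (‖y q‖ ^ 2))

/-- The grid times take countably many values, so conditioning on a random grid time reduces to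
fixed times. -/
theorem exists_time_eq (S : AdaptiveScheme m) (K : ℕ) (X : Euc m) (e : ℕ → Euc m) (n : ℕ) :
    ∃ r : ℚ≥0, S.time K X e n = S.maxStep * ((r : ℝ≥0) : ℝ) := by
  induction n with
  | zero => exact ⟨0, by simp [time_zero]⟩
  | succ n ih =>
    obtain ⟨r, hr⟩ := ih
    refine ⟨r + 1 / 2 ^ S.stepExponent (S.chain K X e n).1 (S.chain K X e n).2, ?_⟩
    rw [time_succ, hr, nextStep, stepSize]
    push_cast
    ring

namespace Admissible

theorem drivenState_eq (h : S.Admissible α β B) {K : ℕ} {X : Euc m} {e : ℕ → Euc m}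
    {V : ℝ≥0 → Euc m} (hV : S.DrivenBy K X e V) (n : ℕ) :
    S.drivenState K X V n = (S.chain K X e n, (S.time K X e n).toNNReal) := by
  induction n with
  | zero => simp [drivenState, chain, time_zero]
  | succ n ih =>
    have ht : (S.time K X e (n + 1)).toNNReal =
        (S.time K X e n).toNNReal + (S.nextStep (S.chain K X e n)).toNNReal := by
      rw [time_succ, Real.toNNReal_add (h.time_nonneg K X e n) (h.nextStep_pos _).le]
    have hn := hV n
    rw [ht] at hn
    rw [drivenState, ih, ht, chain_succ, nextState]
    simp only
    rw [← hn, map_smul, step_eq]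

theorem measurable_excursionSup (h : S.Admissible α β B) (lam : ℝ) :
    Measurable fun p : (Euc m × ℕ) × (ℝ≥0 → Euc m) => S.excursionSup α β B lam p.1 p.2 := by
  have hR : Measurable fun p : (Euc m × ℕ) × (ℝ≥0 → Euc m) => S.sizeSq α p.1.1 := by
    unfold sizeSq; fun_prop
  have hD : Measurable fun p : (Euc m × ℕ) × (ℝ≥0 → Euc m) => S.nextStep p.1 :=
    h.measurable_nextStep.comp measurable_fst
  refine Measurable.iSup fun q => ?_
  have hy : Measurable fun p : (Euc m × ℕ) × (ℝ≥0 → Euc m) => ‖p.2 q‖ ^ 2 :=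
    ((measurable_pi_apply _).comp measurable_snd).norm.pow_const 2
  have hmain : Measurable fun p : (Euc m × ℕ) × (ℝ≥0 → Euc m) =>
      ENNReal.ofReal (excursionExcess lam (S.rate β) (S.noiseConst β B) (S.sizeSq α p.1.1)
        (q : ℝ≥0) (‖p.2 q‖ ^ 2)) := by
    unfold excursionExcess
    fun_prop
  simp_rw [iSup_eq_if]
  exact Measurable.ite (measurableSet_le measurable_const hD) hmain measurable_const

section Driven

variable {Ω : Type*} {mΩ : MeasurableSpace Ω} {μ : Measure Ω} {V : ℝ≥0 → Ω → Euc m}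

open IsMeasurablePreBrownianEuc

/-- Each grid time is a stopping time and the state is known when it is reached. In the induction,
if the last exponent is k, the previous grid time was τ - δ k, and both the state there and the
increment up to τ belong to the past of τ. -/
theorem measurableSet_drivenState (h : S.Admissible α β B) (K : ℕ) (X : Euc m) (n : ℕ) :
    ∀ (τ : ℝ≥0) {A : Set (Euc m × ℕ)}, MeasurableSet A → MeasurableSet[past V τ]
      {ω | (S.drivenState K X (fun t => V t ω) n).2 = τ ∧
        (S.drivenState K X (fun t => V t ω) n).1 ∈ A} := by
  induction n with
  | zero => exact fun τ A _ => @MeasurableSet.const Ω (past V τ) ((0 : ℝ≥0) = τ ∧ (X, K) ∈ A)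
  | succ n ih =>
    intro τ A hA
    let δ : ℕ → ℝ≥0 := fun k => (S.stepSize k).toNNReal
    let D : Ω → (Euc m × ℕ) × ℝ≥0 := fun ω => S.drivenState K X (fun t => V t ω) n
    -- The condition δ k ≤ τ excludes spurious cases of the truncated subtraction τ - δ k.
    have hset : {ω | (S.drivenState K X (fun t => V t ω) (n + 1)).2 = τ ∧
        (S.drivenState K X (fun t => V t ω) (n + 1)).1 ∈ A} =
        ⋃ k : ℕ, {ω | δ k ≤ τ ∧ ((D ω).2 = τ - δ k ∧ (D ω).1 ∈ Set.univ) ∧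
          (S.stepExponent (D ω).1.1 (D ω).1.2 = k ∧
          (S.eulerMap (D ω).1.1 (S.stepSize k) + S.diffusion (D ω).1.1 (V τ ω - V (τ - δ k) ω), k)
            ∈ A)} := by
      ext ω
      simp only [Set.mem_ofPred_eq, Set.mem_iUnion, Set.mem_univ, and_true]
      constructor
      · rintro ⟨h1, h2⟩
        rw [drivenState] at h1 h2
        simp only at h1 h2
        have h3 : (D ω).2 = τ - δ (S.stepExponent (D ω).1.1 (D ω).1.2) := by
          rw [← h1]; exact (add_tsub_cancel_right _ _).symm
        refine ⟨_, ?_, h3, rfl, ?_⟩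
        · rw [← h1]; exact le_add_self
        · rw [← h3]
          rw [h1] at h2
          exact h2
      · rintro ⟨k, h1, h2, h3, h4⟩
        rw [drivenState]
        simp only
        have h5 : (D ω).2 + (S.nextStep (D ω).1).toNNReal = τ := by
          rw [h2, nextStep, h3]; exact tsub_add_cancel_of_le h1
        refine ⟨h5, ?_⟩
        change (S.eulerMap (D ω).1.1 (S.nextStep (D ω).1) + S.diffusion (D ω).1.1
          (V ((D ω).2 + (S.nextStep (D ω).1).toNNReal) ω - V (D ω).2 ω),
          S.stepExponent (D ω).1.1 (D ω).1.2) ∈ A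
        rw [h5, h2, nextStep, h3]
        exact h4
    rw [hset]
    refine @MeasurableSet.iUnion _ _ (past V τ) _ _ fun k => ?_
    have hle : past V (τ - δ k) ≤ past V τ := past_mono tsub_le_self
    have hE : MeasurableSet[past V τ] {ω | (D ω).2 = τ - δ k ∧ (D ω).1 ∈ Set.univ} :=
      hle _ (ih (τ - δ k) MeasurableSet.univ)
    classical
    -- The state is measurable for the past only on the event that the grid time has this value. The
    -- default off the event makes it globally measurable.
    let ζ : Ω → Euc m × ℕ := fun ω => if (D ω).2 = τ - δ k then (D ω).1 else (0, 0)
    have hζ : Measurable[past V τ] ζ := by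
      intro A' hA'
      have e : ζ ⁻¹' A' = {ω | (D ω).2 = τ - δ k ∧ (D ω).1 ∈ A'} ∪
          ({ω | (D ω).2 = τ - δ k ∧ (D ω).1 ∈ Set.univ}ᶜ ∩ {_ω | ((0 : Euc m), (0 : ℕ)) ∈ A'}) := by
        ext ω
        by_cases hc : (D ω).2 = τ - δ k <;> simp [ζ, hc]
      rw [e]
      exact (hle _ (ih (τ - δ k) hA')).union (hE.compl.inter (@MeasurableSet.const _ (past V τ) _))
    let Γ : (Euc m × ℕ) × Euc m → ℕ × (Euc m × ℕ) := fun p =>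
      (S.stepExponent p.1.1 p.1.2, (S.eulerMap p.1.1 (S.stepSize k) + S.diffusion p.1.1 p.2, k))
    have hΓ : Measurable Γ := by
      have g1 : Measurable fun p : (Euc m × ℕ) × Euc m => S.stepExponent p.1.1 p.1.2 :=
        h.measurable_stepExponent.comp measurable_fst
      have g2 : Measurable fun p : (Euc m × ℕ) × Euc m =>
          S.eulerMap p.1.1 (S.stepSize k) + S.diffusion p.1.1 p.2 := by
        have hc : Continuous fun p : Euc m × Euc m =>
            S.eulerMap p.1 (S.stepSize k) + S.diffusion p.1 p.2 := by
          have := h.continuous_diffusion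
          have := h.continuous_drift
          unfold eulerMap
          fun_prop
        exact hc.measurable.comp ((measurable_fst.comp measurable_fst).prodMk measurable_snd)
      exact g1.prodMk (g2.prodMk measurable_const)
    have hinc : Measurable[past V τ] fun ω => V τ ω - V (τ - δ k) ω :=
      (measurable_past le_rfl).sub (measurable_past tsub_le_self)
    have hcomb := hΓ.comp (hζ.prodMk hinc)
    have hpre : MeasurableSet ({k} ×ˢ A : Set (ℕ × (Euc m × ℕ))) :=
      (measurableSet_singleton k).prod hA
    have hfin := (@MeasurableSet.const _ (past V τ) (δ k ≤ τ)).inter (hE.inter (hcomb hpre))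
    convert hfin using 1
    ext ω
    by_cases hc : (D ω).2 = τ - δ k <;> simp [ζ, Γ, hc]

/-- Expected excess of the excursions in the `n`-th step, weighted by the state. -/
theorem lintegral_weight_mul_excursionSup_le (h : S.Admissible α β B) [IsProbabilityMeasure μ]
    (hV : IsMeasurablePreBrownianEuc V μ) {lam : ℝ} (hlam : 0 < lam)
    (hA : 8 * m * (lam * S.noiseConst β B) ≤ 1) (K : ℕ) (X : Euc m) (n : ℕ)
    (hgrid : ∀ ω, ∃ r : ℚ≥0,
      (S.drivenState K X (fun t => V t ω) n).2 = (S.maxStep * ((r : ℝ≥0) : ℝ)).toNNReal) :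
    ∫⁻ ω, ENNReal.ofReal (Real.exp (lam * (‖(S.drivenState K X (fun t => V t ω) n).1.1‖ ^ 2 -
          S.growth α β B * (S.drivenState K X (fun t => V t ω) n).2))) *
        S.excursionSup α β B lam (S.drivenState K X (fun t => V t ω) n).1
          (fun t => V ((S.drivenState K X (fun t => V t ω) n).2 + t) ω -
            V (S.drivenState K X (fun t => V t ω) n).2 ω) ∂μ ≤
      ∫⁻ ω, ENNReal.ofReal (Real.exp (lam * (‖(S.drivenState K X (fun t => V t ω) n).1.1‖ ^ 2 -
          S.growth α β B * (S.drivenState K X (fun t => V t ω) n).2))) *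
        ENNReal.ofReal (excursionConst m lam (S.rate β) * (1 - Real.exp (-(lam * S.rate β *
          (S.sizeSq α (S.drivenState K X (fun t => V t ω) n).1.1 *
            S.nextStep (S.drivenState K X (fun t => V t ω) n).1))))) ∂μ := by
  classical
  let D : Ω → (Euc m × ℕ) × ℝ≥0 := fun ω => S.drivenState K X (fun t => V t ω) n
  let τ : ℚ≥0 → ℝ≥0 := fun r => (S.maxStep * ((r : ℝ≥0) : ℝ)).toNNReal
  let G : Euc m × ℕ → ENNReal := fun p => ENNReal.ofReal (excursionConst m lam (S.rate β) *
    (1 - Real.exp (-(lam * S.rate β * (S.sizeSq α p.1 * S.nextStep p)))))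
  let f : Euc m × ℕ → ℝ≥0 → ENNReal := fun p t =>
    ENNReal.ofReal (Real.exp (lam * (‖p.1‖ ^ 2 - S.growth α β B * t)))
  change ∫⁻ ω, f (D ω).1 (D ω).2 * S.excursionSup α β B lam (D ω).1
    (fun t => V ((D ω).2 + t) ω - V (D ω).2 ω) ∂μ ≤ ∫⁻ ω, f (D ω).1 (D ω).2 * G (D ω).1 ∂μ
  have hτ : Function.Injective τ := by
    intro r r' hrr
    have h1 := congrArg (fun t : ℝ≥0 => (t : ℝ)) hrr
    simp only [τ] at h1
    rw [Real.coe_toNNReal _ (mul_nonneg h.maxStep_pos.le (NNReal.coe_nonneg _)),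
      Real.coe_toNNReal _ (mul_nonneg h.maxStep_pos.le (NNReal.coe_nonneg _))] at h1
    have h2 := mul_left_cancel₀ h.maxStep_pos.ne' h1
    exact_mod_cast h2
  -- The events that the n-th grid time equals τ r partition Ω. On each one the subsequent
  -- increments are those after a fixed time, independent of the state and of the event itself.
  let E : ℚ≥0 → Set Ω := fun r => {ω | (D ω).2 = τ r}
  have hEpast : ∀ r, MeasurableSet[past V (τ r)] (E r) := fun r => by
    have := h.measurableSet_drivenState (V := V) K X n (τ r) MeasurableSet.univ
    simpa only [Set.mem_univ, and_true] using this
  have hEm : ∀ r, MeasurableSet (E r) := fun r => hV.past_le _ _ (hEpast r)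
  have hEd : Pairwise (Function.onFun Disjoint E) := fun r r' hrr =>
    Set.disjoint_left.2 fun ω h1 h2 => hrr (hτ (Eq.trans (Eq.symm h1) h2))
  have hEu : ⋃ r, E r = Set.univ := Set.eq_univ_of_forall fun ω => by
    obtain ⟨r, hr⟩ := hgrid ω
    exact Set.mem_iUnion.2 ⟨r, hr⟩
  rw [← setLIntegral_univ, ← setLIntegral_univ (fun ω => f (D ω).1 (D ω).2 * G (D ω).1), ← hEu,
    lintegral_iUnion hEm hEd, lintegral_iUnion hEm hEd]
  refine ENNReal.tsum_le_tsum fun r => ?_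
  let ζ : Ω → Euc m × ℕ := fun ω => if (D ω).2 = τ r then (D ω).1 else (0, 0)
  have hζ : Measurable[past V (τ r)] ζ := by
    intro A' hA'
    have e : ζ ⁻¹' A' = {ω | (D ω).2 = τ r ∧ (D ω).1 ∈ A'} ∪
        ((E r)ᶜ ∩ {_ω | ((0 : Euc m), (0 : ℕ)) ∈ A'}) := by
      ext ω
      by_cases hc : (D ω).2 = τ r <;> simp [ζ, E, hc]
    rw [e]
    exact (h.measurableSet_drivenState K X n (τ r) hA').union
      ((hEpast r).compl.inter (@MeasurableSet.const _ (past V (τ r)) _))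
  let g : Ω → ENNReal := (E r).indicator fun ω => f (ζ ω) (τ r)
  have hfm : Measurable fun p => f p (τ r) := by
    simp only [f]; fun_prop
  have hg : Measurable[past V (τ r)] g :=
    Measurable.indicator (f := fun ω => f (ζ ω) (τ r)) (s := E r) (hfm.comp hζ) (hEpast r)
  have hYm : Measurable fun ω (t : ℝ≥0) => V (τ r + t) ω - V (τ r) ω :=
    measurable_pi_lambda _ fun t => (hV.measurable _).sub (hV.measurable _)
  have key := lintegral_mul_le_of_indep (hV.past_le (τ r)) hYm (hV.indep_past (τ r)) hζ
    (F := fun p y => S.excursionSup α β B lam p y) (h.measurable_excursionSup lam) (G := G)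
    (fun p => lintegral_iSup_excursionExcess_le hlam h.rate_pos h.noiseConst_pos hA
      (h.sizeSq_pos _) (h.nextStep_pos p) (w := fun t ω => V (τ r + t) ω - V (τ r) ω)
      (fun i => (hV.preBrownian i).shift (τ r))
      (fun t => (hV.measurable _).sub (hV.measurable _)) (fun ω => by simp)) hg
  have hconv : ∀ H H' : Ω → ENNReal, (∀ ω ∈ E r, f (D ω).1 (D ω).2 * H ω = f (ζ ω) (τ r) * H' ω) →
      ∫⁻ ω in E r, f (D ω).1 (D ω).2 * H ω ∂μ = ∫⁻ ω, g ω * H' ω ∂μ := by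
    intro H H' hH
    rw [← lintegral_indicator (hEm r)]
    refine lintegral_congr fun ω => ?_
    by_cases hω : ω ∈ E r
    · simp only [g, Set.indicator_of_mem hω]; exact hH ω hω
    · simp only [g, Set.indicator_of_notMem hω, zero_mul]
  have hζE : ∀ ω ∈ E r, ζ ω = (D ω).1 := fun ω hω => if_pos hω
  rw [hconv _ (fun ω => S.excursionSup α β B lam (ζ ω) fun t => V (τ r + t) ω - V (τ r) ω)
      (fun ω hω => by rw [hζE ω hω]; rw [show (D ω).2 = τ r from hω]),
    hconv _ (fun ω => G (ζ ω))
      (fun ω hω => by rw [hζE ω hω]; rw [show (D ω).2 = τ r from hω])]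
  exact key

end Driven

end Admissible

end AdaptiveScheme


/-! ### The exponential moment of the continuous interpolant. -/

namespace AdaptiveScheme

variable {m : ℕ} {S : AdaptiveScheme m} {α β B : ℝ}

/-- The weighted worst excess of the excursions in the `n`-th step. -/
def drivenExcess (S : AdaptiveScheme m) (α β B lam : ℝ) (K : ℕ) (X : Euc m) (V : ℝ≥0 → Euc m)
    (n : ℕ) : ENNReal :=
  ENNReal.ofReal (Real.exp (lam * (‖(S.drivenState K X V n).1.1‖ ^ 2 -
      S.growth α β B * (S.drivenState K X V n).2))) *
    S.excursionSup α β B lam (S.drivenState K X V n).1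
      (fun t => V ((S.drivenState K X V n).2 + t) - V (S.drivenState K X V n).2)

theorem exists_drivenState_time_eq (S : AdaptiveScheme m) (hS : 0 < S.maxStep) (K : ℕ) (X : Euc m)
    (V : ℝ≥0 → Euc m) (n : ℕ) :
    ∃ r : ℚ≥0, (S.drivenState K X V n).2 = (S.maxStep * ((r : ℝ≥0) : ℝ)).toNNReal := by
  induction n with
  | zero => exact ⟨0, by simp [drivenState]⟩
  | succ n ih =>
    obtain ⟨r, hr⟩ := ih
    refine ⟨r + 1 / 2 ^ S.stepExponent (S.drivenState K X V n).1.1 (S.drivenState K X V n).1.2, ?_⟩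
    rw [drivenState]
    simp only
    rw [hr, nextStep, stepSize, ← Real.toNNReal_add (by positivity) (by positivity)]
    congr 1
    push_cast
    ring

namespace Admissible

section Driven

variable {Ω : Type*} {mΩ : MeasurableSpace Ω} {μ : Measure Ω} {V : ℝ≥0 → Ω → Euc m}

theorem measurable_drivenState (h : S.Admissible α β B) (hV : IsMeasurablePreBrownianEuc V μ)
    (K : ℕ) (X : Euc m) (n : ℕ) :
    Measurable fun ω => S.drivenState K X (fun t => V t ω) n := by
  have hset : ∀ (r : ℚ≥0) {A : Set (Euc m × ℕ)}, MeasurableSet A →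
      MeasurableSet {ω | (S.drivenState K X (fun t => V t ω) n).2 =
        (S.maxStep * ((r : ℝ≥0) : ℝ)).toNNReal ∧
        (S.drivenState K X (fun t => V t ω) n).1 ∈ A} := fun r A hA =>
    hV.past_le _ _ (h.measurableSet_drivenState K X n _ hA)
  have hgrid := fun ω => S.exists_drivenState_time_eq h.maxStep_pos K X (fun t => V t ω) n
  refine Measurable.prodMk (fun A hA => ?_) (fun A hA => ?_)
  · convert MeasurableSet.iUnion fun r : ℚ≥0 => hset r hA using 1
    ext ω
    obtain ⟨r, hr⟩ := hgrid ω
    simp only [Set.mem_preimage, Set.mem_iUnion, Set.mem_ofPred_eq]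
    exact ⟨fun hω => ⟨r, hr, hω⟩, fun ⟨_, _, hω⟩ => hω⟩
  · convert MeasurableSet.iUnion fun r : ℚ≥0 => (hset r MeasurableSet.univ).inter
      (MeasurableSet.const ((S.maxStep * ((r : ℝ≥0) : ℝ)).toNNReal ∈ A)) using 1
    ext ω
    obtain ⟨r, hr⟩ := hgrid ω
    simp only [Set.mem_preimage, Set.mem_iUnion, Set.mem_inter_iff, Set.mem_ofPred_eq,
      Set.mem_univ, and_true]
    exact ⟨fun hω => ⟨r, hr, hr ▸ hω⟩, fun ⟨_, h1, h2⟩ => h1 ▸ h2⟩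

/-- V need not be jointly measurable in time and sample point. Its value at a random grid time is
still measurable, because that time has countably many values. -/
theorem measurable_drivenExcess (h : S.Admissible α β B) (hV : IsMeasurablePreBrownianEuc V μ)
    (lam : ℝ) (K : ℕ) (X : Euc m) (n : ℕ) :
    Measurable fun ω => S.drivenExcess α β B lam K X (fun t => V t ω) n := by
  have hD := h.measurable_drivenState hV K X n
  have hgrid := fun ω => S.exists_drivenState_time_eq h.maxStep_pos K X (fun t => V t ω) n
  have hVt : ∀ t, Measurable fun ω => V ((S.drivenState K X (fun t => V t ω) n).2 + t) ω := by
    intro t A hA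
    convert MeasurableSet.iUnion fun r : ℚ≥0 => ((measurable_snd.comp hD)
      (measurableSet_singleton (S.maxStep * ((r : ℝ≥0) : ℝ)).toNNReal)).inter
      (hV.measurable ((S.maxStep * ((r : ℝ≥0) : ℝ)).toNNReal + t) hA) using 1
    ext ω
    obtain ⟨r, hr⟩ := hgrid ω
    simp only [Set.mem_preimage, Set.mem_iUnion, Set.mem_inter_iff, Function.comp_apply,
      Set.mem_singleton_iff]
    exact ⟨fun hω => ⟨r, hr, hr ▸ hω⟩, fun ⟨_, h1, h2⟩ => h1 ▸ h2⟩
  have hV0 : Measurable fun ω => V (S.drivenState K X (fun t => V t ω) n).2 ω := by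
    simpa using hVt 0
  have hinc : Measurable fun ω (t : ℝ≥0) => V ((S.drivenState K X (fun t => V t ω) n).2 + t) ω -
      V (S.drivenState K X (fun t => V t ω) n).2 ω :=
    measurable_pi_lambda _ fun t => (hVt t).sub hV0
  have hΦ := (h.measurable_excursionSup lam).comp ((measurable_fst.comp hD).prodMk hinc)
  have hw : Measurable fun p : (Euc m × ℕ) × ℝ≥0 =>
      ENNReal.ofReal (Real.exp (lam * (‖p.1.1‖ ^ 2 - S.growth α β B * p.2))) := by fun_prop
  exact (hw.comp hD).mul hΦ

theorem excursionConst_nonneg {lam b : ℝ} (hlam : 0 < lam) (hb : 0 < b) :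
    0 ≤ excursionConst m lam b := by
  have h1 : Real.exp (-(lam * b / 2)) ≤ 1 := by
    rw [Real.exp_le_one_iff]; have : 0 < lam * b / 2 := by positivity
    linarith
  have h2 : Real.exp (-(lam * b)) ≤ 1 := by
    rw [Real.exp_le_one_iff]; have : 0 < lam * b := by positivity
    linarith
  exact div_nonneg (by positivity) (mul_nonneg (by linarith) (by linarith))

/-- Excursions at real times are controlled by excursions at rational times. -/
theorem ofReal_excursionExcess_le_excursionSup (h : S.Admissible α β B) {lam : ℝ}
    {p : Euc m × ℕ} {w y : ℝ≥0 → Euc m} (hw : Continuous w) (hwy : ∀ q : ℚ≥0, w q = y q) {u : ℝ≥0}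
    (hu : (u : ℝ) < S.nextStep p) :
    ENNReal.ofReal (excursionExcess lam (S.rate β) (S.noiseConst β B) (S.sizeSq α p.1) u
      (‖w u‖ ^ 2)) ≤ S.excursionSup α β B lam p y := by
  have hR := h.sizeSq_pos p.1
  have hcont : Continuous fun v : ℝ≥0 => ENNReal.ofReal (excursionExcess lam (S.rate β)
      (S.noiseConst β B) (S.sizeSq α p.1) v (‖w v‖ ^ 2)) := by
    unfold excursionExcess
    have hne : ∀ v : ℝ≥0, (v : ℝ) + 1 / S.sizeSq α p.1 ≠ 0 := fun v => by positivity
    refine ENNReal.continuous_ofReal.comp ?_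
    fun_prop (disch := exact hne)
  have hclosed : IsClosed {v : ℝ≥0 | ENNReal.ofReal (excursionExcess lam (S.rate β)
      (S.noiseConst β B) (S.sizeSq α p.1) v (‖w v‖ ^ 2)) ≤ S.excursionSup α β B lam p y} :=
    isClosed_le hcont continuous_const
  have hopen : IsOpen {v : ℝ≥0 | (v : ℝ) < S.nextStep p} :=
    isOpen_lt NNReal.continuous_coe continuous_const
  have hdense : Dense (Set.range fun q : ℚ≥0 => (q : ℝ≥0)) := by
    refine dense_of_exists_between fun a b hab => ?_
    obtain ⟨q, haq, hqb⟩ := exists_rat_btwn (NNReal.coe_lt_coe.2 hab)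
    have hq : 0 ≤ q := by exact_mod_cast (a.2.trans haq.le : (0 : ℝ) ≤ q)
    lift q to ℚ≥0 using hq
    refine ⟨(q : ℝ≥0), ⟨q, rfl⟩, ?_, ?_⟩
    · exact_mod_cast haq
    · exact_mod_cast hqb
  -- The bound holds at rational times before the end of the step, and these are dense in an open
  -- set of times. By continuity of w it extends to u.
  refine closure_minimal ?_ hclosed (hdense.open_subset_closure_inter hopen hu)
  rintro _ ⟨hv, q, rfl⟩
  have hv' : ((q : ℝ≥0) : ℝ) < S.nextStep p := hv
  simp only [Set.mem_ofPred_eq]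
  rw [hwy]
  exact le_iSup₂_of_le (f := fun (q : ℚ≥0) (_ : ((q : ℝ≥0) : ℝ) ≤ S.nextStep p) =>
    ENNReal.ofReal (excursionExcess lam (S.rate β) (S.noiseConst β B) (S.sizeSq α p.1) (q : ℝ≥0)
      (‖y q‖ ^ 2))) q hv'.le le_rfl

/-- Pathwise bound of the continuous interpolant by the weights and the excursions. -/
theorem ofReal_exp_norm_contInterp_sq_le (h : S.Admissible α β B) {lam : ℝ} (hlam : 0 < lam)
    {K : ℕ} {X : Euc m} {e : ℕ → Euc m} {W V : ℝ≥0 → Euc m}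
    (ht : Filter.Tendsto (S.time K X e) Filter.atTop Filter.atTop) (hW : S.DrivenBy K X e W)
    (hWc : Continuous W)
    (hWV : ∀ r q : ℚ≥0, W ((S.maxStep * ((r : ℝ≥0) : ℝ)).toNNReal + q) =
      V ((S.maxStep * ((r : ℝ≥0) : ℝ)).toNNReal + q))
    (hD : ∀ n, S.drivenState K X V n = (S.chain K X e n, (S.time K X e n).toNNReal))
    {t T : ℝ} (ht0 : 0 ≤ t) (htT : t ≤ T) :
    ENNReal.ofReal (Real.exp (lam * ‖S.contInterp K X e W t‖ ^ 2)) ≤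
      ENNReal.ofReal (Real.exp (lam * S.growth α β B * T + lam * S.rate β / 2)) *
        ((⨆ n, ENNReal.ofReal (S.weight α β B lam K X e n)) +
          ∑' n, S.drivenExcess α β B lam K X V n) := by
  set n := S.index K X e t with hn
  obtain ⟨h1, h2⟩ := h.index_spec ht ht0
  rw [← hn] at h1 h2
  have hn0 := h.time_nonneg K X e n
  set σ := (S.time K X e n).toNNReal with hσ
  have hσc : (σ : ℝ) = S.time K X e n := Real.coe_toNNReal _ hn0
  set p := S.chain K X e n with hp
  have hpos : S.pos K X e n = p.1 := rfl
  set u := (t - S.time K X e n).toNNReal with hu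
  have huc : (u : ℝ) = t - S.time K X e n := Real.coe_toNNReal _ (sub_nonneg.2 h1)
  have htu : t.toNNReal = σ + u := by
    rw [hσ, hu, ← Real.toNNReal_add hn0 (sub_nonneg.2 h1)]; congr 1; ring
  have huΔ : (u : ℝ) < S.nextStep p := by
    rw [huc]; rw [time_succ, ← hp] at h2; linarith
  have hX := h.contInterp_eq ht hW h1 h2
  rw [hpos, ← huc, htu, ← hσ] at hX
  set w : Euc m := W (σ + u) - W σ with hw
  have hbound := h.norm_interp_sq_le (x := p.1) (h.nextStep_pos p) (h.nextStep_le p)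
    (h.nextStep_tol p) u.coe_nonneg huΔ.le w
  rw [← hX] at hbound
  obtain ⟨r, hr⟩ := S.exists_time_eq K X e n
  have hσr : σ = (S.maxStep * ((r : ℝ≥0) : ℝ)).toNNReal := by rw [hσ, hr]
  have hex := h.ofReal_excursionExcess_le_excursionSup (lam := lam) (p := p)
    (w := fun v => W (σ + v) - W σ) (y := fun v => V (σ + v) - V σ) (by fun_prop)
    (fun q => by
      have h0 := hWV r 0
      simp only [NNRat.cast_zero, add_zero] at h0
      simp only [hσr]
      rw [hWV r q, h0]) huΔ
  set ex := excursionExcess lam (S.rate β) (S.noiseConst β B) (S.sizeSq α p.1) u (‖w‖ ^ 2)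
    with hexdef
  have hwt : S.weight α β B lam K X e n =
      Real.exp (lam * (‖p.1‖ ^ 2 - S.growth α β B * σ)) := by rw [weight, hpos, hσc]
  have hreal : Real.exp (lam * ‖S.contInterp K X e W t‖ ^ 2) ≤
      Real.exp (lam * S.growth α β B * T + lam * S.rate β / 2) *
        (S.weight α β B lam K X e n * (1 + ex)) := by
    have e1 : 1 + ex = Real.exp (lam * (-(S.rate β / 2) * S.sizeSq α p.1 * u +
        S.noiseConst β B * ‖w‖ ^ 2 / (u + 1 / S.sizeSq α p.1))) := by
      rw [hexdef, excursionExcess]; ring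
    rw [e1, hwt, ← Real.exp_add, ← Real.exp_add]
    apply Real.exp_le_exp.2
    have h3 := mul_le_mul_of_nonneg_left hbound hlam.le
    have h4 : lam * S.growth α β B * (σ + u) ≤ lam * S.growth α β B * T :=
      mul_le_mul_of_nonneg_left (by rw [hσc, huc]; linarith) (mul_pos hlam h.growth_pos).le
    linarith
  have hw0 : 0 ≤ S.weight α β B lam K X e n := (Real.exp_pos _).le
  calc ENNReal.ofReal (Real.exp (lam * ‖S.contInterp K X e W t‖ ^ 2))
      ≤ ENNReal.ofReal (Real.exp (lam * S.growth α β B * T + lam * S.rate β / 2)) *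
        (ENNReal.ofReal (S.weight α β B lam K X e n) * (1 + ENNReal.ofReal ex)) := by
        refine (ENNReal.ofReal_le_ofReal hreal).trans ?_
        rw [ENNReal.ofReal_mul (Real.exp_pos _).le, ENNReal.ofReal_mul hw0]
        gcongr
        exact ENNReal.ofReal_add_le.trans_eq (by rw [ENNReal.ofReal_one])
    _ ≤ ENNReal.ofReal (Real.exp (lam * S.growth α β B * T + lam * S.rate β / 2)) *
        (ENNReal.ofReal (S.weight α β B lam K X e n) + S.drivenExcess α β B lam K X V n) := by
        gcongr
        rw [mul_add, mul_one, drivenExcess, hD n, hwt]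
        gcongr
    _ ≤ _ := by
        gcongr
        · exact le_iSup (fun n => ENNReal.ofReal (S.weight α β B lam K X e n)) n
        · exact ENNReal.le_tsum n

/-- The path is controlled by the largest weight plus the sum of all weighted excesses. The maximal
inequality contributes the first term, the telescoping sum times `excursionConst` the second. -/
theorem expSupMoment_contInterp_le (h : S.Admissible α β B) [IsProbabilityMeasure μ]
    {η : ℕ → Ω → Euc m} (hη : ∀ n, Measurable (η n))
    (hlaw : ∀ n, μ.map (η n) = stdGaussian (Euc m)) (hind : iIndepFun η μ) {lam : ℝ}
    (hlam : 0 < lam) (h1 : 8 * (2 * lam) * B ^ 2 ≤ 2 * β - S.tol)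
    (h2 : 8 * m * (2 * lam) * B ^ 2 * S.maxStep ≤ 1)
    (h3 : 8 * m * (lam * S.noiseConst β B) ≤ 1) (K : ℕ) (X : Euc m) (T : ℝ)
    {W : ℝ≥0 → Ω → Euc m} (hW : IsBrownianEuc W μ)
    (hdriven : ∀ᵐ ω ∂μ, S.DrivenBy K X (fun n => η n ω) (fun t => W t ω)) :
    expSupMoment μ lam T (fun t ω => S.contInterp K X (fun n => η n ω) (fun t => W t ω) t) ≤
      ENNReal.ofReal (Real.exp (lam * S.growth α β B * T + lam * S.rate β / 2)) *
        (ENNReal.ofReal (2 * Real.exp (lam * ‖X‖ ^ 2)) +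
          ENNReal.ofReal (excursionConst m lam (S.rate β)) *
            ENNReal.ofReal (Real.exp (lam * ‖X‖ ^ 2))) := by
  obtain ⟨V, hV, hWV⟩ := hW.exists_modification
  have hcont : ∀ᵐ ω ∂μ, Continuous fun t => W t ω := by
    filter_upwards [ae_all_iff.2 fun i => (hW.brownian i).cont] with ω hω
    exact (PiLp.continuous_toLp 2 (fun _ : Fin m => ℝ)).comp (continuous_pi hω)
  have hWV' : ∀ᵐ ω ∂μ, ∀ r q : ℚ≥0, W ((S.maxStep * ((r : ℝ≥0) : ℝ)).toNNReal + q) ω =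
      V ((S.maxStep * ((r : ℝ≥0) : ℝ)).toNNReal + q) ω :=
    ae_all_iff.2 fun r => ae_all_iff.2 fun q => hWV _
  have hD : ∀ᵐ ω ∂μ, ∀ n, S.drivenState K X (fun t => V t ω) n =
      (S.chain K X (fun n => η n ω) n, (S.time K X (fun n => η n ω) n).toNNReal) := by
    filter_upwards [hdriven, hWV'] with ω hω hωV n
    refine h.drivenState_eq (fun k => ?_) n
    have hgrid : ∀ j, W (S.time K X (fun n => η n ω) j).toNNReal ω =
        V (S.time K X (fun n => η n ω) j).toNNReal ω := by
      intro j
      obtain ⟨r, hr⟩ := S.exists_time_eq K X (fun n => η n ω) j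
      have := hωV r 0
      rw [hr]
      simpa using this
    have := hω k
    simpa only [hgrid] using this
  have h1' : 8 * lam * B ^ 2 ≤ 2 * β - S.tol := by
    have : 0 ≤ lam * B ^ 2 := by positivity
    linarith
  have h2' : 8 * m * lam * B ^ 2 * S.maxStep ≤ 1 := by
    have : 0 ≤ 8 * m * lam * B ^ 2 * S.maxStep := by
      have := h.maxStep_pos
      positivity
    linarith
  -- The excess is estimated through the path V, the resulting gains through the noise η. The two
  -- descriptions of the chain agree almost surely.
  have hsum : ∑' n, ∫⁻ ω, S.drivenExcess α β B lam K X (fun t => V t ω) n ∂μ ≤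
      ENNReal.ofReal (excursionConst m lam (S.rate β)) *
        ENNReal.ofReal (Real.exp (lam * ‖X‖ ^ 2)) := by
    refine le_trans ?_ (mul_le_mul_right
      (h.tsum_lintegral_weight_mul_le hη hlaw hind hlam h1' h2' K X) _)
    rw [← ENNReal.tsum_mul_left]
    refine ENNReal.tsum_le_tsum fun n => ?_
    refine (h.lintegral_weight_mul_excursionSup_le hV hlam h3 K X n fun ω =>
      S.exists_drivenState_time_eq h.maxStep_pos K X (fun t => V t ω) n).trans ?_
    rw [← lintegral_const_mul' _ _ ENNReal.ofReal_ne_top]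
    refine lintegral_mono_ae ?_
    filter_upwards [hD] with ω hω
    simp only [hω n]
    rw [Real.coe_toNNReal _ (h.time_nonneg K X _ n),
      ENNReal.ofReal_mul (excursionConst_nonneg hlam h.rate_pos), mul_left_comm]
    rfl
  have hwm : Measurable fun ω =>
      ⨆ n, ENNReal.ofReal (S.weight α β B lam K X (fun n => η n ω) n) :=
    Measurable.iSup fun n =>
      ((h.measurable_weight lam K X n).mono (noisePast_le hη n) le_rfl).ennreal_ofReal
  have hdm := fun n => h.measurable_drivenExcess hV lam K X n
  calc expSupMoment μ lam T (fun t ω => S.contInterp K X (fun n => η n ω) (fun t => W t ω) t)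
      ≤ ∫⁻ ω, ENNReal.ofReal (Real.exp (lam * S.growth α β B * T + lam * S.rate β / 2)) *
        ((⨆ n, ENNReal.ofReal (S.weight α β B lam K X (fun n => η n ω) n)) +
          ∑' n, S.drivenExcess α β B lam K X (fun t => V t ω) n) ∂μ := by
        refine lintegral_mono_ae ?_
        filter_upwards [h.ae_tendsto_time hη hlaw hind hlam h1 h2 K X, hdriven, hcont, hWV', hD]
          with ω g1 g2 g3 g4 g5
        exact exp_mul_iSup_norm_sq_le hlam fun t ht =>
          h.ofReal_exp_norm_contInterp_sq_le hlam g1 g2 g3 g4 g5 ht.1 ht.2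
    _ = ENNReal.ofReal (Real.exp (lam * S.growth α β B * T + lam * S.rate β / 2)) *
        (∫⁻ ω, ⨆ n, ENNReal.ofReal (S.weight α β B lam K X (fun n => η n ω) n) ∂μ +
          ∑' n, ∫⁻ ω, S.drivenExcess α β B lam K X (fun t => V t ω) n ∂μ) := by
        rw [lintegral_const_mul' _ _ ENNReal.ofReal_ne_top, lintegral_add_left hwm,
          lintegral_tsum fun n => (hdm n).aemeasurable]
    _ ≤ _ := by
        gcongr
        exact h.lintegral_iSup_weight_le hη hlaw hind hlam h1 h2 K X

end Driven

end Admissible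

end AdaptiveScheme

end

/-! ### Choice of the constants and conclusion. -/

theorem theorem4 {m : ℕ} (S : AdaptiveScheme m) (α β : ℝ)
    (hf : ContDiff ℝ 2 S.drift) (hg : ContDiff ℝ 2 S.diffusion)
    (hα : 0 < α) (hβ : 0 < β)
    (hcoercive : ∀ x : Euc m, inner ℝ (S.drift x) x ≤ α - β * ‖x‖ ^ 2)
    (hbdd : ∃ B : ℝ, ∀ x : Euc m, ‖S.diffusion x‖ ≤ B)
    (hinv : ∀ x : Euc m, IsUnit (S.diffusion x))
    (hτ : 0 < S.tol) (hτβ : S.tol < 2 * β) (hΔ : 0 < S.maxStep) :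
    ∃ lam : ℝ, 0 < lam ∧ ∀ T₀ : ℝ, 0 < T₀ → ∃ c : ℝ, 0 < c ∧
      ∀ (Ω : Type*) [MeasurableSpace Ω] (μ : Measure Ω) [IsProbabilityMeasure μ]
        (η : ℕ → Ω → Euc m), (∀ n, HasLaw (η n) (stdGaussian (Euc m)) μ) → iIndepFun η μ →
      ∀ (K : ℕ) (X : Euc m),
        -- almost surely the interpolants are defined for all times
        (∀ᵐ ω ∂μ, Filter.Tendsto (S.time K X (fun n => η n ω)) Filter.atTop Filter.atTop) ∧
        ∀ T : ℝ, T₀ ≤ T →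
          -- the piecewise constant interpolant
          expSupMoment μ lam T (fun t ω => S.pcInterp K X (fun n => η n ω) t)
              ≤ ENNReal.ofReal (Real.exp (lam * ‖X‖ ^ 2 + c * T)) ∧
          -- the continuous interpolant, for any Brownian motion that drives the scheme
          ∀ W : ℝ≥0 → Ω → Euc m, IsBrownianEuc W μ →
            (∀ᵐ ω ∂μ, S.DrivenBy K X (fun n => η n ω) (fun t => W t ω)) →
            expSupMoment μ lam T
                (fun t ω => S.contInterp K X (fun n => η n ω) (fun t => W t ω) t)
              ≤ ENNReal.ofReal (Real.exp (lam * ‖X‖ ^ 2 + c * T)) := by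
  obtain ⟨B₀, hB₀⟩ := hbdd
  set B := max B₀ 1 with hB
  have h : S.Admissible α β B := ⟨hf.continuous, hg.continuous, hα, hcoercive, le_max_right _ _,
    fun x => (hB₀ x).trans (le_max_left _ _), hτ, hτβ, hΔ⟩
  have hBpos := h.B_pos
  have hgap := h.gap_pos
  have hA := h.noiseConst_pos
  have hb := h.rate_pos
  have hgr := h.growth_pos
  -- The three summands correspond to the three smallness conditions: absorbing the cross term,
  -- integrability of the squared Gaussian, and integrability of the excursions. With `lam` = 1/Q
  -- all of them hold.
  set Q := 16 * B ^ 2 / (2 * β - S.tol) + 16 * m * B ^ 2 * S.maxStep +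
    8 * m * S.noiseConst β B with hQ
  have hQ1 : 0 < 16 * B ^ 2 / (2 * β - S.tol) := by positivity
  have hQ2 : 0 ≤ 16 * m * B ^ 2 * S.maxStep := by positivity
  have hQ3 : 0 ≤ 8 * m * S.noiseConst β B := by positivity
  have hQpos : 0 < Q := by linarith
  have hlam : 0 < Q⁻¹ := inv_pos.2 hQpos
  have hle : ∀ z, z ≤ Q → Q⁻¹ * z ≤ 1 := fun z hz => by
    rw [inv_mul_le_iff₀ hQpos]; linarith
  have h1 : 8 * (2 * Q⁻¹) * B ^ 2 ≤ 2 * β - S.tol := by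
    have := hle (16 * B ^ 2 / (2 * β - S.tol)) (by linarith)
    rw [← mul_div_assoc, div_le_one hgap] at this
    linarith
  have h2 : 8 * m * (2 * Q⁻¹) * B ^ 2 * S.maxStep ≤ 1 := by
    have := hle (16 * m * B ^ 2 * S.maxStep) (by linarith)
    linarith
  have h3 : 8 * m * (Q⁻¹ * S.noiseConst β B) ≤ 1 := by
    have := hle (8 * m * S.noiseConst β B) (by linarith)
    linarith
  set lam := Q⁻¹
  set C := excursionConst m lam (S.rate β)
  have hC : 0 ≤ C := AdaptiveScheme.Admissible.excursionConst_nonneg hlam hb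
  have hlog : 0 ≤ Real.log (2 + C) := Real.log_nonneg (by linarith)
  -- The prefactor (2 + C) exp(λ · rate/2) does not depend on T. Dividing its logarithm by T₀ makes
  -- it at most exponential in T for T ≥ T₀.
  refine ⟨lam, hlam, fun T₀ hT₀ =>
    ⟨lam * S.growth α β B + (lam * S.rate β / 2 + Real.log (2 + C)) / T₀, by positivity, ?_⟩⟩
  intro Ω _ μ _ η hlaw hind K X
  set c := lam * S.growth α β B + (lam * S.rate β / 2 + Real.log (2 + C)) / T₀ with hc
  -- `HasLaw` provides only almost everywhere measurability, so the noise is replaced by a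
  -- measurable version. Almost surely the two sequences agree for all n at once.
  let η' : ℕ → Ω → Euc m := fun n => (hlaw n).aemeasurable.mk (η n)
  have hηη' : ∀ n, η n =ᵐ[μ] η' n := fun n => (hlaw n).aemeasurable.ae_eq_mk
  have hη' : ∀ n, Measurable (η' n) := fun n => (hlaw n).aemeasurable.measurable_mk
  have hlaw' : ∀ n, μ.map (η' n) = stdGaussian (Euc m) := fun n => by
    rw [← Measure.map_congr (hηη' n)]; exact (hlaw n).map_eq
  have hind' : iIndepFun η' μ := hind.congr hηη'
  have hall : ∀ᵐ ω ∂μ, (fun n => η n ω) = fun n => η' n ω := by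
    filter_upwards [ae_all_iff.2 hηη'] with ω hω
    exact funext hω
  have hfinal : ∀ T, T₀ ≤ T → Real.exp (lam * S.growth α β B * T + lam * S.rate β / 2) *
      ((2 + C) * Real.exp (lam * ‖X‖ ^ 2)) ≤ Real.exp (lam * ‖X‖ ^ 2 + c * T) := by
    intro T hT
    rw [← Real.exp_log (show 0 < 2 + C by linarith), ← Real.exp_add, ← Real.exp_add,
      Real.exp_le_exp]
    have h4 : lam * S.rate β / 2 + Real.log (2 + C) ≤
        (lam * S.rate β / 2 + Real.log (2 + C)) / T₀ * T := by
      rw [div_mul_eq_mul_div, le_div_iff₀ hT₀]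
      exact mul_le_mul_of_nonneg_left hT (by positivity)
    rw [hc, add_mul]
    linarith
  refine ⟨?_, fun T hT => ⟨?_, fun W hW hdriven => ?_⟩⟩
  · filter_upwards [hall, h.ae_tendsto_time hη' hlaw' hind' hlam h1 h2 K X] with ω e1 e2
    rw [e1]; exact e2
  · calc expSupMoment μ lam T (fun t ω => S.pcInterp K X (fun n => η n ω) t)
        = expSupMoment μ lam T (fun t ω => S.pcInterp K X (fun n => η' n ω) t) := by
          refine lintegral_congr_ae ?_
          filter_upwards [hall] with ω e1
          simp only [e1]
      _ ≤ _ := h.expSupMoment_pcInterp_le hη' hlaw' hind' hlam h1 h2 K X T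
      _ = ENNReal.ofReal (Real.exp (lam * S.growth α β B * T) *
            (2 * Real.exp (lam * ‖X‖ ^ 2))) := (ENNReal.ofReal_mul (Real.exp_pos _).le).symm
      _ ≤ _ := by
          refine ENNReal.ofReal_le_ofReal (le_trans ?_ (hfinal T hT))
          gcongr
          · have : 0 ≤ lam * S.rate β / 2 := by positivity
            linarith
          · linarith
  · have hdriven' : ∀ᵐ ω ∂μ, S.DrivenBy K X (fun n => η' n ω) (fun t => W t ω) := by
      filter_upwards [hall, hdriven] with ω e1 e2
      rw [← e1]; exact e2
    calc expSupMoment μ lam T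
          (fun t ω => S.contInterp K X (fun n => η n ω) (fun t => W t ω) t)
        = expSupMoment μ lam T
          (fun t ω => S.contInterp K X (fun n => η' n ω) (fun t => W t ω) t) := by
          refine lintegral_congr_ae ?_
          filter_upwards [hall] with ω e1
          simp only [e1]
      _ ≤ _ := h.expSupMoment_contInterp_le hη' hlaw' hind' hlam h1 h2 h3 K X T hW hdriven'
      _ = ENNReal.ofReal (Real.exp (lam * S.growth α β B * T + lam * S.rate β / 2) *
            ((2 + C) * Real.exp (lam * ‖X‖ ^ 2))) := by
          rw [← ENNReal.ofReal_mul hC, ← ENNReal.ofReal_add (by positivity) (by positivity),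
            ← ENNReal.ofReal_mul (Real.exp_pos _).le, add_mul]
      _ ≤ _ := ENNReal.ofReal_le_ofReal (hfinal T hT)
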